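/- Let $X$ be a finite dimensional real vector space, $\Lambda\subset X$ a lattice of full rank, and $Q$ an inner product on $X$ that is rational, i.e. $Q(x,y)\in\mathbb{Q}$ for all rational points $x,y$ (points with a nonzero integer multiple in $\Lambda$). Let $C=\sum_{e\in E}\mathbb{R}_{+}e$ be a unimodular cone, where $E$ is a (possibly empty) subset of a $\mathbb{Z}$-basis of $\Lambda$. For $S\subset X$ nonempty let $L(S)$ be the span of the differences of points of $S$ and $\dim S=\dim L(S)$. Let $\mathcal{F}(C)$ be the finite set of nonempty faces of $C$ (including $C$); for $F\in\mathcal{F}(C)$ put $I_F=\{e\in E: e\notin F\}$. Integrals over $F$ are with respect to the Lebesgue measure on $L(F)$ for which a fundamental domain of $L(F)\cap\Lambda$ has measure $1$. For $u\in X$ let $\nabla_u$ be the derivative in the direction $u$. *The operators.* With $S(\cdot,\cdot)$ the Stirling numbers of the second kind, let $$p(n,k)=\sum_{t=0}^{k}\binom{n}{t}(-1)^{t}S(n-t,k-t),\qquad p(n)=\sum_{\mu=n}^{2n}(-1)^{\mu}\frac{(\mu-n)!}{\mu!}\,p(\mu,\mu-n).$$ For $I\subset E$ and $e\in E$ let $X(I)=\mathrm{span}(E\setminus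 I)$ and write $e=u(I;e)+\sum_{v\in E\setminus I}c(I;e,v)\,v$ with $u(I;e)\perp_Q X(I)$. For $I,J\subset E$ and a multi-index $\alpha\in\mathbb{Z}_{\ge0}^{E}$ define $L(E;I,J;\alpha)$ recursively by $L(E;I,J;0)=\delta_{I,J}$ and $$L(E;I,J;\beta+\lambda_e)=L(E;I,J;\beta)\nabla_{u(I;e)}+\sum_{v\in J\setminus I}c(I;e,v)\,L(E;I\cup\{v\},J;\beta),$$ where $\lambda_e$ is the indicator of $\{e\}$; the result does not depend on the order in which the elements $e$ are split off. For $F\in\mathcal{F}(C)$ and $n\ge0$ with $\dim F\ge\dim C-n$ let $$\mathcal{D}_n^X(C;F)=(-1)^{n-\dim C+\dim F}\sum_{I\subset I_F}\ \sum_{\nu\in\mathbb{Z}_{>0}^{I},\,|\nu|=n}\Big(\prod_{e\in I}p(\nu(e))\Big)L\Big(E;I,I_F;\nu-\sum_{e\in I}\lambda_e\Big)$$ (for $I=\emptyset$ the inner sum has the single term $\nu=0$ if $n=0$, and is empty if $n\ge1$; so $\mathcal{D}_0^X(C;C)=1$ and $\mathcal{D}_n^X(C;C)=0$ for $n\geq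 1$). **Theorem.** (a) For all $F\in\mathcal{F}(C)$ and $n\ge 0$ with $\dim F\ge\dim C-n$, $\mathcal{D}_n^X(C;F)$ is a homogeneous differential operator of order $n-\dim C+\dim F$ with rational constant coefficients, which differentiates only in directions of $L(C)$ that are $Q$-orthogonal to $L(F)$: it is a finite sum of operators $q\nabla_{w_1}\cdots\nabla_{w_k}$ with $k=n-\dim C+\dim F$, $q\in\mathbb{Q}$ and rational points $w_i\in L(C)\cap L(F)^{\perp_Q}$. (b) For every Schwartz function $\varphi\in\mathcal{S}(X)$ the Riemann sums $$R_N(C;\varphi)=\frac1{N^{\dim C}}\sum_{\gamma\in C\cap\Lambda}\varphi(\gamma/N)\qquad(N=1,2,\dots)$$ converge absolutely, the integrals below converge absolutely, and $$R_N(C;\varphi)\sim\sum_{n\ge0}N^{-n}\sum_{F\in\mathcal{F}(C),\ \dim F\ge\dim C-n}\int_F\mathcal{D}_n^X(C;F)\varphi\qquad(N\to\infty),$$ i.e. for every $K\ge0$ the difference of $R_N(C;\varphi)$ and the sum of the terms with $n<K$ is $O(N^{-K})$. -/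

import Mathlib

open MeasureTheory Filter Asymptotics
open scoped SchwartzMap LineDeriv Topology

noncomputable section

namespace ConeEM

variable {X : Type*} [NormedAddCommGroup X] [InnerProductSpace ℝ X]

/-! ### The rational numbers `p(n)` -/

/-- `p(n, k) = ∑_{t=0}^{k} (n choose t) (-1)^t S(n-t, k-t)`, with `S` the Stirling numbers of the
second kind. -/
def stirlingP (n k : ℕ) : ℚ :=
  ∑ t ∈ Finset.range (k + 1),
    (n.choose t : ℚ) * (-1) ^ t * (Nat.stirlingSecond (n - t) (k - t) : ℚ)

/-- `p(n) = ∑_{n ≤ μ ≤ 2n} (-1)^μ ((μ-n)! / μ!) p(μ, μ-n)`. -/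
def toddP (n : ℕ) : ℚ :=
  ∑ m ∈ Finset.Icc n (2 * n),
    (-1) ^ m * ((Nat.factorial (m - n) : ℚ) / (Nat.factorial m : ℚ)) * stirlingP m (m - n)

/-! ### Rational points, unimodular cones, faces -/

/-- `x` is a rational point of `(X, Λ)`: a nonzero integer multiple of `x` lies in `Λ`. -/
def IsRationalPoint (Λ : Submodule ℤ X) (x : X) : Prop :=
  ∃ q : ℤ, q ≠ 0 ∧ q • x ∈ Λ

/-- The inner product of `X` is rational: it takes rational values on rational points. -/
def IsRationalInner (Λ : Submodule ℤ X) : Prop :=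
  ∀ x y : X, IsRationalPoint Λ x → IsRationalPoint Λ y → ∃ q : ℚ, inner ℝ x y = (q : ℝ)

/-- `E` is a subset of an integral basis (a `ℤ`-basis) of the lattice `Λ`. -/
def IsPartOfIntegralBasis (Λ : Submodule ℤ X) (E : Finset X) : Prop :=
  ∃ B : Set X, (E : Set X) ⊆ B ∧ LinearIndepOn ℤ id B ∧ Submodule.span ℤ B = Λ

/-- The cone `∑_{e ∈ E} ℝ₊ e` generated by `E`. -/
def coneGen (E : Finset X) : Set X :=
  {x | ∃ t : X → ℝ, (∀ e ∈ E, 0 ≤ t e) ∧ x = ∑ e ∈ E, t e • e}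

/-- The set of (nonempty) faces of `C`: the sets where a linear form attains its maximum over `C`.
In particular `C` is a face of itself. -/
def faces (C : Set X) : Set (Set X) :=
  {F | F.Nonempty ∧ IsExposed ℝ C F}

/-- The dimension of a set: the dimension of the space `L(S)` spanned by the differences of its
points. -/
def sdim (S : Set X) : ℕ :=
  Module.finrank ℝ (vectorSpan ℝ S)

/-! ### The normalised Lebesgue measure and the Riemann sums -/

/-- The Lebesgue measure on the subspace `L` normalised so that a fundamental domain of the lattice
`L ∩ Λ` has measure `1`. -/
def latticeMeasure [FiniteDimensional ℝ X] [MeasurableSpace X] [BorelSpace X]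
    (Λ : Submodule ℤ X) (L : Submodule ℝ X) : Measure L :=
  (ENNReal.ofReal (ZLattice.covolume (ZLattice.comap ℝ Λ L.subtype)))⁻¹ • (volume : Measure L)

/-- The part of `F` in `L(F)`, as a subset of `L(F)`; it is all of `F` when `0 ∈ F`. -/
def inDirection (F : Set X) : Set (vectorSpan ℝ F) :=
  Subtype.val ⁻¹' F

/-- The Riemann sum `R_N(C; φ) = N^{-dim C} ∑_{γ ∈ C ∩ Λ} φ(γ / N)`. -/
def riemannSum (Λ : Submodule ℤ X) (C : Set X) (φ : 𝓢(X, ℂ)) (N : ℕ) : ℂ :=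
  ((N : ℂ) ^ sdim C)⁻¹ * ∑' γ : {γ : X // γ ∈ C ∧ γ ∈ Λ}, φ ((N : ℝ)⁻¹ • (γ : X))

/-! ### Constant coefficient differential operators -/

/-- Continuous linear operators on the Schwartz space, with composition as multiplication. -/
abbrev Op (X : Type*) [NormedAddCommGroup X] [InnerProductSpace ℝ X] : Type _ :=
  𝓢(X, ℂ) →L[ℝ] 𝓢(X, ℂ)

/-- The derivative `∇_u` in the direction `u`. -/
def dirDeriv (u : X) : Op X :=
  LineDeriv.lineDerivOpCLM ℝ 𝓢(X, ℂ) u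

theorem dirDeriv_comm (u v : X) : dirDeriv u * dirDeriv v = dirDeriv v * dirDeriv u := by
  ext φ x
  have h : ∀ a b : X, (dirDeriv a * dirDeriv b) φ x = fderiv ℝ (fderiv ℝ φ) x a b := by
    intro a b
    change (∂_{a} (∂_{b} φ : 𝓢(X, ℂ)) : 𝓢(X, ℂ)) x = _
    rw [SchwartzMap.lineDerivOp_apply_eq_fderiv]
    have h1 : ((∂_{b} φ : 𝓢(X, ℂ)) : X → ℂ) = fun y => fderiv ℝ φ y b := by
      ext y; exact SchwartzMap.lineDerivOp_apply_eq_fderiv b φ y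
    have h2 : DifferentiableAt ℝ (fderiv ℝ φ) x :=
      ((φ.smooth 2).fderiv_right (m := 1) (by norm_num)).differentiable (by norm_num) x
    rw [h1, fderiv_clm_apply h2 (differentiableAt_const b)]
    simp
  rw [h, h]
  exact ((φ.smooth 2).contDiffAt.isSymmSndFDerivAt (by simp)) u v

/-- `D` is a homogeneous differential operator of order `k` with rational constant coefficients,
which differentiates only in directions in `M`: a sum of operators `q ∇_{w₁} ⋯ ∇_{w_k}` with
`q ∈ ℚ` and rational points `w₁, …, w_k` of `M`. -/
def IsRationalHomogeneousAlong (Λ : Submodule ℤ X) (M : Submodule ℝ X) (k : ℕ) (D : Op X) : Prop :=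
  D ∈ AddSubgroup.closure {T : Op X | ∃ (q : ℚ) (w : List X), w.length = k ∧
    (∀ x ∈ w, x ∈ M ∧ IsRationalPoint Λ x) ∧ T = (q : ℝ) • (w.map dirDeriv).prod}

/-! ### The operators produced by integration by parts -/

open Classical in
/-- `X(I)`, the span of `E \ I`. -/
def spanCompl (E I : Finset X) : Submodule ℝ X :=
  Submodule.span ℝ ((E \ I : Finset X) : Set X)

variable [FiniteDimensional ℝ X]

/-- `u(I; e)`: the component of `e` orthogonal to `X(I)`. -/
def perpPart (E I : Finset X) (e : X) : X :=
  e - (spanCompl E I).starProjection e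

open Classical in
theorem exists_projCoeff (E I : Finset X) (e : X) :
    ∃ c : X → ℝ, Function.support c ⊆ ((E \ I : Finset X) : Set X) ∧
      ∑ v ∈ E \ I, c v • v = (spanCompl E I).starProjection e :=
  Submodule.mem_span_finset.1 (Submodule.starProjection_apply_mem (spanCompl E I) e)

/-- `c(I; e, v)`: the coefficients in `e = u(I; e) + ∑_{v ∈ E \ I} c(I; e, v) v`. They are unique
when `E` is linearly independent. -/
def projCoeff (E I : Finset X) (e v : X) : ℝ :=
  (exists_projCoeff E I e).choose v

open Classical in
/-- The operator `L(E; I, J; α)`, where the multi-index `α` is given as a list of elements of `E`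
(each `e` repeated `α(e)` times), by the recursion
`L(I, J; 0) = δ_{I,J}`,
`L(I, J; e + β) = L(I, J; β) ∇_{u(I; e)} + ∑_{v ∈ J \ I} c(I; e, v) L(I ∪ {v}, J; β)`.
It vanishes unless `I ⊆ J` and `|J| ≤ |I| + |α|`. -/
def ibpList (E : Finset X) : List X → Finset X → Finset X → Op X
  | [], I, J => if I = J then 1 else 0
  | e :: l, I, J =>
      ibpList E l I J * dirDeriv (perpPart E I e) +
        ∑ v ∈ J \ I, projCoeff E I e v • ibpList E l (insert v I) J

/-- `L(E; I, J; α)` for a multi-index `α`, seen as a multiset. By `ibpList_perm` the order in which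
the elements of `α` are used in the recursion does not matter. -/
def ibpOp (E I J : Finset X) (α : Multiset X) : Op X :=
  ibpList E α.toList I J

open Classical in
/-- `I_F ⊆ E`: the generators that do not lie on the face `F`, so that `F` is generated by
`E \ I_F`. -/
def faceIndex (E : Finset X) (F : Set X) : Finset X :=
  E.filter (fun e => e ∉ F)

open Classical in
/-- The operator `𝒟_n(C; F)` for the unimodular cone `C` generated by `E` and a face `F` of `C`:
`(-1)^{n - |I_F|} ∑_{I ⊆ I_F} ∑_ν p_I(ν) L(E; I, I_F; ν - e(I))`,
where `ν` runs over the multi-indices with support exactly `I` and `|ν| = n`, where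
`p_I(ν) = ∏_{e ∈ I} p(ν(e))`, and where `e(I)` is the indicator function of `I`.
Here `|I_F| = dim C - dim F`. -/
def coneOp (n : ℕ) (E : Finset X) (F : Set X) : Op X :=
  (-1 : ℝ) ^ (n - (faceIndex E F).card) •
    ∑ I ∈ (faceIndex E F).powerset,
      ∑ ν ∈ (I.finsuppAntidiag n).filter (fun ν : X →₀ ℕ => ν.support = I),
        ((∏ e ∈ I, toddP (ν e) : ℚ) : ℝ) •
          ibpOp E I (faceIndex E F) (Finsupp.toMultiset ν - I.val)

/-- The coefficient of `N^{-n}`: the sum of `∫_F 𝒟_n(C; F) φ` over the faces `F` of the cone `C`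
generated by `E` with `dim F ≥ dim C - n`. -/
def expansionCoeff [MeasurableSpace X] [BorelSpace X] (Λ : Submodule ℤ X) (E : Finset X)
    (φ : 𝓢(X, ℂ)) (n : ℕ) : ℂ :=
  ∑ᶠ F ∈ {F : Set X | F ∈ faces (coneGen E) ∧ sdim (coneGen E) ≤ sdim F + n},
    ∫ x in inDirection F, coneOp n E F φ (x : X) ∂(latticeMeasure Λ (vectorSpan ℝ F))

/-! ### The operators `L(E; I, J; α)` are well defined -/

open Classical in
theorem projCoeff_unique {E I : Finset X} (hE : LinearIndepOn ℝ id (E : Set X)) {e : X}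
    {c : X → ℝ} (hc : ∑ v ∈ E \ I, c v • v = (spanCompl E I).starProjection e) {v : X}
    (hv : v ∈ E \ I) : projCoeff E I e v = c v := by
  have h1 := (exists_projCoeff E I e).choose_spec.2
  have h2 : ∑ v ∈ E \ I, (projCoeff E I e v - c v) • v = 0 := by
    simp only [sub_smul, Finset.sum_sub_distrib, hc]
    rw [sub_eq_zero]; exact h1
  have hE' : LinearIndepOn ℝ id ((E \ I : Finset X) : Set X) :=
    hE.mono (by simp)
  rw [linearIndepOn_finset_iff] at hE'
  exact sub_eq_zero.1 (hE' _ h2 v hv)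

open Classical in
theorem starProjection_insert (E I : Finset X) (e : X) {v : X} (hv : v ∈ E \ I) :
    (spanCompl E (insert v I)).starProjection e =
      ∑ w ∈ E \ insert v I, projCoeff E I e w • w +
        projCoeff E I e v • (spanCompl E (insert v I)).starProjection v := by
  have h1 : ∑ w ∈ E \ I, projCoeff E I e w • w = (spanCompl E I).starProjection e :=
    (exists_projCoeff E I e).choose_spec.2
  have h2 : E \ I = insert v (E \ insert v I) := by
    ext w
    simp only [Finset.mem_sdiff, Finset.mem_insert] at hv ⊢
    by_cases h : w = v
    · subst h; simp [hv]
    · simp [h]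
  have hle : spanCompl E (insert v I) ≤ spanCompl E I :=
    Submodule.span_mono (by
      intro w hw
      simp only [Finset.coe_sdiff, Set.mem_sdiff, Finset.mem_coe, Finset.mem_insert] at hw ⊢
      exact ⟨hw.1, fun h => hw.2 (Or.inr h)⟩)
  have h3 : (spanCompl E (insert v I)).starProjection e =
      (spanCompl E (insert v I)).starProjection ((spanCompl E I).starProjection e) := by
    have := Submodule.starProjection_comp_starProjection_of_le hle
    exact (DFunLike.congr_fun this e).symm
  rw [h3, ← h1, h2, Finset.sum_insert (by simp), map_add, map_smul, add_comm]
  congr 1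
  apply Submodule.starProjection_eq_self_iff.2
  exact Submodule.sum_mem _ fun w hw => Submodule.smul_mem _ _ (Submodule.subset_span hw)

open Classical in
theorem perpPart_insert (E I : Finset X) (e : X) {v : X} (hv : v ∈ E \ I) :
    perpPart E (insert v I) e =
      perpPart E I e + projCoeff E I e v • perpPart E (insert v I) v := by
  have h1 : ∑ w ∈ E \ I, projCoeff E I e w • w = (spanCompl E I).starProjection e :=
    (exists_projCoeff E I e).choose_spec.2
  have h2 : E \ I = insert v (E \ insert v I) := by
    ext w
    simp only [Finset.mem_sdiff, Finset.mem_insert] at hv ⊢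
    by_cases h : w = v
    · subst h; simp [hv]
    · simp [h]
  unfold perpPart
  rw [starProjection_insert E I e hv, ← h1, h2, Finset.sum_insert (by simp), smul_sub]
  abel

open Classical in
theorem projCoeff_insert {E I : Finset X} (hE : LinearIndepOn ℝ id (E : Set X)) (e : X)
    {v w : X} (hv : v ∈ E \ I) (hw : w ∈ E \ insert v I) :
    projCoeff E (insert v I) e w =
      projCoeff E I e w + projCoeff E I e v * projCoeff E (insert v I) v w := by
  refine projCoeff_unique (c := fun w => projCoeff E I e w +
    projCoeff E I e v * projCoeff E (insert v I) v w) hE ?_ hw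
  have h1 : ∑ w ∈ E \ insert v I, projCoeff E (insert v I) v w • w =
      (spanCompl E (insert v I)).starProjection v :=
    (exists_projCoeff E (insert v I) v).choose_spec.2
  rw [starProjection_insert E I e hv, ← h1, Finset.smul_sum, ← Finset.sum_add_distrib]
  exact Finset.sum_congr rfl fun w _ => by rw [add_smul, mul_smul]

open Classical in
theorem ibpList_swap {E : Finset X} (hE : LinearIndepOn ℝ id (E : Set X)) (l : List X)
    (e f : X) (I J : Finset X) (hJ : J ⊆ E) :
    ibpList E (e :: f :: l) I J = ibpList E (f :: e :: l) I J := by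
  -- the part of the twofold recursion that is not visibly symmetric
  have key : ∀ a b : X, ibpList E (a :: b :: l) I J =
      ibpList E l I J * (dirDeriv (perpPart E I b) * dirDeriv (perpPart E I a)) +
      ∑ v ∈ J \ I, (ibpList E l (insert v I) J *
        (projCoeff E I b v • dirDeriv (perpPart E I a) +
          projCoeff E I a v • dirDeriv (perpPart E I b) +
          (projCoeff E I a v * projCoeff E I b v) • dirDeriv (perpPart E (insert v I) v))) +
      ((∑ v ∈ J \ I, ∑ w ∈ J \ I, if v = w then 0 else
        (projCoeff E I a v * projCoeff E I b w) • ibpList E l (insert w (insert v I)) J) +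
      ∑ v ∈ J \ I, ∑ w ∈ J \ insert v I,
        (projCoeff E I a v * projCoeff E I b v * projCoeff E (insert v I) v w) •
          ibpList E l (insert w (insert v I)) J) := by
    intro a b
    have hsub : ∀ v ∈ J \ I, v ∈ E \ I := fun v hv =>
      Finset.mem_sdiff.2 ⟨hJ (Finset.mem_sdiff.1 hv).1, (Finset.mem_sdiff.1 hv).2⟩
    have hone : ∀ v ∈ J \ I, projCoeff E I a v • ibpList E (b :: l) (insert v I) J =
        ibpList E l (insert v I) J *
          (projCoeff E I a v • dirDeriv (perpPart E I b) +
            (projCoeff E I a v * projCoeff E I b v) • dirDeriv (perpPart E (insert v I) v)) +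
        ((∑ w ∈ J \ I, if v = w then 0 else
          (projCoeff E I a v * projCoeff E I b w) • ibpList E l (insert w (insert v I)) J) +
        ∑ w ∈ J \ insert v I,
          (projCoeff E I a v * projCoeff E I b v * projCoeff E (insert v I) v w) •
            ibpList E l (insert w (insert v I)) J) := by
      intro v hv
      have hd : dirDeriv (perpPart E (insert v I) b) = dirDeriv (perpPart E I b) +
          projCoeff E I b v • dirDeriv (perpPart E (insert v I) v) := by
        rw [perpPart_insert E I b (hsub v hv)]
        ext φ x
        simp [dirDeriv, LineDeriv.lineDerivOp_left_add, LineDeriv.lineDerivOp_left_smul]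
      have hs : J \ I = insert v (J \ insert v I) := by
        ext w
        simp only [Finset.mem_sdiff, Finset.mem_insert] at hv ⊢
        by_cases h : w = v
        · subst h; simp [hv]
        · simp [h]
      have hsum : (∑ w ∈ J \ I, if v = w then (0 : Op X) else
          (projCoeff E I a v * projCoeff E I b w) • ibpList E l (insert w (insert v I)) J) =
          ∑ w ∈ J \ insert v I,
            (projCoeff E I a v * projCoeff E I b w) •
              ibpList E l (insert w (insert v I)) J := by
        rw [hs, Finset.sum_insert (by simp), if_pos rfl, zero_add]
        refine Finset.sum_congr rfl fun w hw => if_neg ?_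
        rintro rfl
        simp at hw
      rw [hsum, ← Finset.sum_add_distrib]
      simp only [ibpList]
      rw [hd, smul_add, Finset.smul_sum]
      congr 1
      · simp only [mul_add, mul_smul_comm, smul_add, smul_smul]
      · refine Finset.sum_congr rfl fun w hw => ?_
        have hw' : w ∈ E \ insert v I :=
          Finset.mem_sdiff.2 ⟨hJ (Finset.mem_sdiff.1 hw).1, (Finset.mem_sdiff.1 hw).2⟩
        rw [projCoeff_insert hE b (hsub v hv) hw', smul_smul, ← add_smul]
        congr 1
        ring
    rw [ibpList, Finset.sum_congr rfl hone, Finset.sum_add_distrib, Finset.sum_add_distrib]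
    simp only [ibpList, add_mul, mul_add, Finset.sum_add_distrib, Finset.sum_mul, mul_assoc,
      smul_mul_assoc, mul_smul_comm]
    abel
  rw [key e f, key f e, dirDeriv_comm (perpPart E I f) (perpPart E I e)]
  congr 1
  · congr 1
    refine Finset.sum_congr rfl fun v _ => ?_
    rw [mul_comm (projCoeff E I e v),
      add_comm (projCoeff E I f v • dirDeriv (perpPart E I e))]
  · congr 1
    · rw [Finset.sum_comm]
      refine Finset.sum_congr rfl fun v _ => Finset.sum_congr rfl fun w _ => ?_
      rw [mul_comm, Finset.insert_comm]
      simp only [eq_comm]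
    · refine Finset.sum_congr rfl fun v _ => Finset.sum_congr rfl fun w _ => ?_
      rw [mul_comm (projCoeff E I e v)]

theorem ibpList_perm {E : Finset X} (hE : LinearIndepOn ℝ id (E : Set X)) {l m : List X}
    (h : l.Perm m) {J : Finset X} (hJ : J ⊆ E) (I : Finset X) :
    ibpList E l I J = ibpList E m I J := by
  induction h generalizing I with
  | nil => rfl
  | cons e _ ih => simp only [ibpList, ih]
  | swap e f l => exact ibpList_swap hE l f e I J hJ
  | trans _ _ h1 h2 => exact (h1 I).trans (h2 I)

end ConeEM

end

open MeasureTheory Filter Asymptotics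
open scoped SchwartzMap LineDeriv Topology NNReal

noncomputable section

namespace ConeEM

set_option linter.unusedSectionVars false

/-! ### The numbers p(n) as signed Bernoulli coefficients. -/

section

/-! The coordinates dual to a ℤ-basis containing `E` identify the cone with the orthant `[0,∞)^E`
and its lattice points with `ℕ^E`. Hence the Riemann sum is the integral of `φ` against the image of
a product of the half line measures `N⁻¹ ∑ δ_{k/N}`, and the normalised integral over a face is the
integral against the image of a product of Lebesgue measures
(`DualSystem.summable_and_riemannSum_eq`, `DualSystem.integral_inDirection`).

In one variable, Euler–Maclaurin expands the sampling measure as Lebesgue measure plus the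
functionals `-(B_j / j!) N^{-j} f^{(j-1)}(0)`. Using it in one generator at a time, together with
Fubini, gives an expansion indexed by multi-indices `ν` on `E` (`eulerMaclaurin_line`,
`emSum_insert`, `eulerMaclaurin_cone`). A generator with `ν(e) = 0` is integrated over; one with
`ν(e) > 0` is set to zero and contributes `ν(e) - 1` derivatives along `e`. The error in one
direction still has to be integrated over the others, so the estimates are uniform in `N` and in the
apex `y` of the translated cone, and decay like a power of `1 + ‖y‖`. Salience of the cone makes
this possible: in a sum of two of its points neither can cancel the other
(`IsSalient.exists_wt_add`).

The resulting terms differentiate in directions that need not be orthogonal to the face of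
integration. Write `e` as its orthogonal part `u(I;e)` plus a combination of the generators of that
face. Derivatives along the latter become, by the fundamental theorem of calculus, minus integrals
over smaller faces; the orthogonal derivatives are kept. Iteration is exactly the recursion for
`L(E;I,J;α)` (`apply_prod_dirDeriv_eq`), and collecting the terms that end on a given face yields
the operators `𝒟_n` (`emSum_eq_sum_indexOp`). The constants match because `p(n) = (-1)^n B_n / n!`
(`toddP_eq`).

Part (a) is read off the same recursion. Each step either differentiates once or enlarges `I` by one
element, which fixes the order. The directions `u(I;e)` are orthogonal to the span of `E \ I`, hence
to every smaller face. Rationality is Gram–Schmidt over `ℚ`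
(`IsRationalInner.exists_sub_orthogonal`). -/

open PowerSeries in
theorem coeff_exp_sub_one_pow (n k : ℕ) :
    coeff n ((exp ℚ - 1) ^ k) = (k.factorial : ℚ) / n.factorial * Nat.stirlingSecond n k := by
  induction n generalizing k with
  | zero =>
    cases k with
    | zero => simp
    | succ k => simp [Nat.stirlingSecond_zero_succ]
  | succ n ih =>
    cases k with
    | zero => simp [Nat.stirlingSecond_succ_zero, coeff_one]
    | succ k =>
      -- Writing `exp = (exp - 1) + 1` in the derivative turns it into the Stirling recursion on
      -- coefficients.
      have hd : d⁄dX ℚ ((exp ℚ - 1) ^ (k + 1)) =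
          ((k + 1 : ℕ) : PowerSeries ℚ) * ((exp ℚ - 1) ^ (k + 1) + (exp ℚ - 1) ^ k) := by
        rw [Derivation.leibniz_pow]
        simp only [map_sub, derivative_exp, add_tsub_cancel_right, smul_eq_mul, nsmul_eq_mul,
          Derivation.map_one_eq_zero]
        ring
      have h := congrArg (coeff n) hd
      rw [coeff_derivative, ← map_natCast (C (R := ℚ)), coeff_C_mul, map_add, ih, ih] at h
      rw [Nat.stirlingSecond_succ_succ]
      have h1 : ((n : ℚ) + 1) ≠ 0 := by positivity
      have h2 : ((n.factorial : ℕ) : ℚ) ≠ 0 := by positivity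
      push_cast [Nat.factorial_succ] at h ⊢
      field_simp at h ⊢
      linear_combination h

-- Binomial expansion in `X` and `exp - 1` produces the defining alternating sum of `p(n, k)`; thus
-- `p(n, k)` counts partitions of `n` elements into `k` blocks of size at least two.
open PowerSeries in
theorem coeff_exp_sub_one_sub_X_pow (n k : ℕ) :
    coeff n ((exp ℚ - 1 - X) ^ k) = (k.factorial : ℚ) / n.factorial * stirlingP n k := by
  have h : (exp ℚ - 1 - X : PowerSeries ℚ) ^ k = ∑ t ∈ Finset.range (k + 1),
      C ((k.choose t : ℚ) * (-1) ^ t) * (X ^ t * (exp ℚ - 1) ^ (k - t)) := by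
    rw [sub_eq_neg_add, add_pow]
    refine Finset.sum_congr rfl fun t _ => ?_
    rw [neg_pow]
    simp
    ring
  rw [h, map_sum, stirlingP, Finset.mul_sum]
  refine Finset.sum_congr rfl fun t ht => ?_
  have htk : t ≤ k := Nat.lt_succ_iff.1 (Finset.mem_range.1 ht)
  rw [coeff_C_mul, coeff_X_pow_mul']
  split_ifs with hn
  · rw [coeff_exp_sub_one_pow, Nat.cast_choose ℚ htk, Nat.cast_choose ℚ hn]
    have h1 : ((n.factorial : ℕ) : ℚ) ≠ 0 := by positivity
    have h2 : (((n - t).factorial : ℕ) : ℚ) ≠ 0 := by positivity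
    have h3 : (((k - t).factorial : ℕ) : ℚ) ≠ 0 := by positivity
    have h4 : ((t.factorial : ℕ) : ℚ) ≠ 0 := by positivity
    field_simp
  · rw [Nat.choose_eq_zero_of_lt (not_le.1 hn)]
    simp

-- Put `exp - 1 = X (1 + G)`. The Bernoulli series is `1 / (1 + G)`, and since `X ∣ G` its
-- coefficient of degree `n` is already that of the geometric sum of `(-G)^k` with `k ≤ n`. The sign
-- `(-1)^n` makes `p(n)` the coefficients of `x / (1 - e^{-x})`.
open PowerSeries in
theorem toddP_eq (n : ℕ) : toddP n = (-1) ^ n * bernoulli n / n.factorial := by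
  obtain ⟨G, hG⟩ : (X : PowerSeries ℚ) ∣ exp ℚ - 1 - X := by
    rw [X_dvd_iff]; simp
  have hG0 : (X : PowerSeries ℚ) ∣ G := by
    rw [X_dvd_iff]
    have h := congrArg (coeff 1) hG
    have h' := coeff_succ_X_mul 0 G
    rw [zero_add] at h'
    rw [h'] at h
    simpa [coeff_exp] using h.symm
  have hX : (X : PowerSeries ℚ) ≠ 0 := X_ne_zero
  have hb : bernoulliPowerSeries ℚ * (1 + G) = 1 := by
    apply mul_left_cancel₀ hX
    have h := bernoulliPowerSeries_mul_exp_sub_one ℚ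
    have h' : exp ℚ - 1 = X * (1 + G) := by rw [mul_add, ← hG]; ring
    rw [h'] at h
    linear_combination h
  have hgeo : (∑ k ∈ Finset.range (n + 1), (-G) ^ k) =
      bernoulliPowerSeries ℚ - bernoulliPowerSeries ℚ * (-G) ^ (n + 1) := by
    have h := geom_sum_mul_neg (-G) (n + 1)
    linear_combination (-(∑ k ∈ Finset.range (n + 1), (-G) ^ k)) * hb +
      bernoulliPowerSeries ℚ * h
  have hc : coeff n (∑ k ∈ Finset.range (n + 1), (-G) ^ k) = bernoulli n / n.factorial := by
    rw [hgeo, map_sub]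
    have h0 : coeff n (bernoulliPowerSeries ℚ * (-G) ^ (n + 1)) = 0 := by
      have hdvd : (X : PowerSeries ℚ) ^ (n + 1) ∣ bernoulliPowerSeries ℚ * (-G) ^ (n + 1) :=
        Dvd.dvd.mul_left (pow_dvd_pow_of_dvd ((dvd_neg).2 hG0) _) _
      exact X_pow_dvd_iff.1 hdvd n (Nat.lt_succ_self n)
    rw [h0, sub_zero]
    simp [bernoulliPowerSeries]
  -- With `μ = n + k`, degree `n` of `G^k` is degree `μ` of `(X G)^k = (exp - 1 - X)^k`, which
  -- explains the range `n ≤ μ ≤ 2n`.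
  rw [mul_div_assoc, ← hc, map_sum, Finset.mul_sum, toddP, two_mul,
    ← Finset.Ico_add_one_right_eq_Icc, Finset.sum_Ico_eq_sum_range,
    show n + n + 1 - n = n + 1 by lia]
  refine Finset.sum_congr rfl fun k _ => ?_
  have h := coeff_exp_sub_one_sub_X_pow (n + k) k
  rw [hG, mul_pow, coeff_X_pow_mul] at h
  have h1 : ((-1) ^ k : PowerSeries ℚ) = C ((-1) ^ k) := by simp
  rw [Nat.add_sub_cancel_left, neg_pow G, h1, coeff_C_mul, h]
  ring

/-- The coefficient of `N^{-j} f^{(j-1)}(0)` in the Euler–Maclaurin expansion of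
`N^{-1} ∑_{k ≥ 0} f(k / N)`. -/
def emCoeff (j : ℕ) : ℝ := -(bernoulli j : ℝ) / j.factorial

/-- The two normalisations of `B_j / j!` differ only in sign. The case `j = 0` must be excluded,
since the truncated exponent `j - 1` would then give the wrong sign. -/
theorem emCoeff_eq {j : ℕ} (hj : j ≠ 0) : emCoeff j = (-1) ^ (j - 1) * (toddP j : ℝ) := by
  obtain ⟨i, rfl⟩ := Nat.exists_eq_succ_of_ne_zero hj
  rw [toddP_eq, emCoeff]
  push_cast
  rw [Nat.succ_eq_add_one, pow_succ]
  have : ((-1 : ℝ) ^ i) * (-1) ^ i = 1 := by rw [← mul_pow]; simp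
  linear_combination (bernoulli (i+1) : ℝ) / (Nat.factorial (i+1) : ℝ) * this

end

/-! ### The Euler–Maclaurin formula in one variable. -/

section

/-- Euler–Maclaurin formula on an interval of length `1`. -/
theorem eulerMaclaurin_unit {g : ℕ → ℝ → ℂ} (hg : ∀ j t, HasDerivAt (g j) (g (j + 1) t) t) (a : ℝ)
    (K : ℕ) :
    g 0 a = (∫ t in a..a + 1, g 0 t) +
      ∑ j ∈ Finset.range (K + 1), (emCoeff (j + 1) : ℂ) * (g j a - g j (a + 1)) +
      (-1) ^ K * ∫ t in a..a + 1,
        ((bernoulliFun (K + 1) (t - a) / (K + 1).factorial : ℝ) : ℂ) * g (K + 1) t := by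
  have hc : ∀ j, Continuous (g j) := fun j =>
    continuous_iff_continuousAt.2 fun t => (hg j t).continuousAt
  have hb : ∀ k : ℕ, ∀ t, HasDerivAt
      (fun t => ((bernoulliFun (k + 1) (t - a) / (k + 1).factorial : ℝ) : ℂ))
      ((bernoulliFun k (t - a) / k.factorial : ℝ) : ℂ) t := by
    intro k t
    have h1 := ((hasDerivAt_bernoulliFun (k + 1) (t - a)).comp t
      ((hasDerivAt_id t).sub_const a)).div_const ((k + 1).factorial : ℝ)
    have h2 : ((k + 1 : ℕ) : ℝ) * bernoulliFun (k + 1 - 1) (t - a) * 1 / (k + 1).factorial =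
        bernoulliFun k (t - a) / k.factorial := by
      rw [Nat.factorial_succ, Nat.add_sub_cancel]
      push_cast
      field_simp
    rw [h2] at h1
    exact h1.ofReal_comp
  have hbc : ∀ k : ℕ, Continuous
      (fun t => ((bernoulliFun k (t - a) / k.factorial : ℝ) : ℂ)) := fun k => by
    have := continuous_bernoulliFun (k := k)
    fun_prop
  -- One integration by parts: by `hb`, `B_{k+1} / (k+1)!` is an antiderivative of `B_k / k!`.
  have parts : ∀ k j : ℕ,
      (∫ t in a..a + 1, ((bernoulliFun k (t - a) / k.factorial : ℝ) : ℂ) * g j t) =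
      ((bernoulliFun (k + 1) 1 / (k + 1).factorial : ℝ) : ℂ) * g j (a + 1) -
        ((bernoulliFun (k + 1) 0 / (k + 1).factorial : ℝ) : ℂ) * g j a -
      ∫ t in a..a + 1,
        ((bernoulliFun (k + 1) (t - a) / (k + 1).factorial : ℝ) : ℂ) * g (j + 1) t := by
    intro k j
    have h := intervalIntegral.integral_mul_deriv_eq_deriv_mul (a := a) (b := a + 1)
      (fun t _ => hb k t) (fun t _ => hg j t)
      ((hbc k).intervalIntegrable _ _) ((hc (j + 1)).intervalIntegrable _ _)
    rw [h]
    simp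
  induction K with
  | zero =>
    have h := parts 0 0
    simp only [bernoulliFun_zero, Nat.factorial_zero, Nat.cast_one, div_one, Complex.ofReal_one,
      one_mul, zero_add, Nat.factorial_one, bernoulliFun_one] at h
    simp only [zero_add, Finset.sum_range_one, emCoeff, bernoulli_one, bernoulliFun_one,
      Nat.factorial_one, Nat.cast_one, div_one]
    generalize (∫ t in a..a + 1, ((t - a - 1 / 2 : ℝ) : ℂ) * g 1 t) = R at h ⊢
    rw [h]
    push_cast
    ring
  | succ K ih =>
    have h := parts (K + 1) (K + 1)
    rw [ih, h, Finset.sum_range_succ _ (K + 1),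
      bernoulliFun_endpoints_eq_of_ne_one (show K + 1 + 1 ≠ 1 by lia), bernoulliFun_eval_zero]
    -- Alternating signs from repeated integration by parts can be dropped: for odd `K` the
    -- Bernoulli number has odd index greater than one and vanishes.
    have hs : ((-1 : ℂ) ^ K) * (bernoulli (K + 1 + 1) : ℂ) = (bernoulli (K + 1 + 1) : ℂ) := by
      rcases Nat.even_or_odd K with hK | hK
      · rw [hK.neg_one_pow, one_mul]
      · rw [bernoulli_eq_zero_of_odd (by simpa [parity_simps] using hK) (by lia)]
        simp
    simp only [emCoeff]
    push_cast
    rw [pow_succ]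
    linear_combination ((g (K + 1) (a + 1) - g (K + 1) a) / ((K + 1 + 1).factorial : ℂ)) * hs

theorem exists_bound_bernoulliFun (K : ℕ) :
    ∃ b : ℝ, 0 ≤ b ∧ ∀ t ∈ Set.Icc (0 : ℝ) 1, |bernoulliFun K t / K.factorial| ≤ b := by
  have hc : ContinuousOn (fun t => bernoulliFun K t / K.factorial) (Set.Icc 0 1) :=
    ((continuous_bernoulliFun (k := K)).div_const _).continuousOn
  obtain ⟨b, hb⟩ := isCompact_Icc.exists_bound_of_continuousOn hc
  exact ⟨b, (norm_nonneg _).trans (hb 0 (by simp)), hb⟩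

/-- The constant depends only on `K`, and the bound is an integral of a derivative over the
interval; hence errors on consecutive unit intervals add up to one integral over the half line. -/
theorem eulerMaclaurin_unit_bound (K : ℕ) : ∃ b : ℝ, 0 ≤ b ∧
    ∀ g : ℕ → ℝ → ℂ, (∀ j t, HasDerivAt (g j) (g (j + 1) t) t) → ∀ a : ℝ,
    ‖g 0 a - (∫ t in a..a + 1, g 0 t) -
      ∑ j ∈ Finset.range (K + 1), (emCoeff (j + 1) : ℂ) * (g j a - g j (a + 1))‖ ≤
      b * ∫ t in a..a + 1, ‖g (K + 1) t‖ := by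
  obtain ⟨b, hb0, hb⟩ := exists_bound_bernoulliFun (K + 1)
  refine ⟨b, hb0, fun g hg a => ?_⟩
  have hc : Continuous (g (K + 1)) :=
    continuous_iff_continuousAt.2 fun t => (hg (K + 1) t).continuousAt
  rw [sub_sub, sub_eq_of_eq_add' (eulerMaclaurin_unit hg a K), norm_mul, norm_pow, norm_neg,
    norm_one, one_pow, one_mul, ← intervalIntegral.integral_const_mul]
  refine intervalIntegral.norm_integral_le_of_norm_le (by linarith) ?_
    (by exact (continuous_const.mul hc.norm).intervalIntegrable _ _)
  refine ae_of_all _ fun t ht => ?_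
  rw [norm_mul, Complex.norm_real]
  exact mul_le_mul_of_nonneg_right
    (hb _ ⟨by linarith [ht.1], by linarith [ht.2]⟩) (norm_nonneg _)

/-- Euler–Maclaurin formula on a half line, with a bound for the remainder. -/
theorem eulerMaclaurin_half_line (K : ℕ) : ∃ b : ℝ, 0 ≤ b ∧
    ∀ g : ℕ → ℝ → ℂ, (∀ j t, HasDerivAt (g j) (g (j + 1) t) t) →
    (∀ j, IntegrableOn (g j) (Set.Ioi 0)) → (∀ j, Tendsto (g j) atTop (𝓝 0)) →
    Summable (fun k : ℕ => g 0 k) →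
    ‖∑' k : ℕ, g 0 k - (∫ t in Set.Ioi (0 : ℝ), g 0 t) -
      ∑ j ∈ Finset.range (K + 1), (emCoeff (j + 1) : ℂ) * g j 0‖ ≤
      b * ∫ t in Set.Ioi (0 : ℝ), ‖g (K + 1) t‖ := by
  obtain ⟨b, hb0, hb⟩ := eulerMaclaurin_unit_bound K
  refine ⟨b, hb0, fun g hg hi ht hs => ?_⟩
  have hc : ∀ j, Continuous (g j) := fun j =>
    continuous_iff_continuousAt.2 fun t => (hg j t).continuousAt
  -- Adding unit intervals telescopes the boundary terms; those at the far end tend to zero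
  -- afterwards.
  have hfin : ∀ n : ℕ, ‖∑ k ∈ Finset.range n, g 0 k - (∫ t in (0 : ℝ)..n, g 0 t) -
      ∑ j ∈ Finset.range (K + 1), (emCoeff (j + 1) : ℂ) * (g j 0 - g j n)‖ ≤
      b * ∫ t in (0 : ℝ)..n, ‖g (K + 1) t‖ := by
    intro n
    induction n with
    | zero => simp
    | succ n ih =>
      have h1 : ∀ f : ℝ → ℂ, Continuous f → (∫ t in (0 : ℝ)..(n + 1 : ℕ), f t) =
          (∫ t in (0 : ℝ)..n, f t) + ∫ t in (n : ℝ)..n + 1, f t := fun f hf => by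
        rw [intervalIntegral.integral_add_adjacent_intervals (hf.intervalIntegrable _ _)
          (hf.intervalIntegrable _ _)]
        simp
      have h2 : (∫ t in (0 : ℝ)..(n + 1 : ℕ), ‖g (K + 1) t‖) =
          (∫ t in (0 : ℝ)..n, ‖g (K + 1) t‖) + ∫ t in (n : ℝ)..n + 1, ‖g (K + 1) t‖ := by
        rw [intervalIntegral.integral_add_adjacent_intervals
          ((hc _).norm.intervalIntegrable _ _) ((hc _).norm.intervalIntegrable _ _)]
        simp
      rw [h1 _ (hc 0), h2, Finset.sum_range_succ, mul_add]
      refine le_trans (le_of_eq ?_) ((norm_add_le _ _).trans (add_le_add ih (hb g hg n)))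
      congr 1
      push_cast
      simp only [mul_sub, Finset.sum_sub_distrib]
      ring
  have hlim : Tendsto (fun n : ℕ => ‖∑ k ∈ Finset.range n, g 0 k - (∫ t in (0 : ℝ)..n, g 0 t) -
      ∑ j ∈ Finset.range (K + 1), (emCoeff (j + 1) : ℂ) * (g j 0 - g j n)‖) atTop
      (𝓝 ‖∑' k : ℕ, g 0 k - (∫ t in Set.Ioi (0 : ℝ), g 0 t) -
      ∑ j ∈ Finset.range (K + 1), (emCoeff (j + 1) : ℂ) * (g j 0 - 0)‖) := by
    refine ((hs.hasSum.tendsto_sum_nat.sub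
      (intervalIntegral_tendsto_integral_Ioi 0 (hi 0) tendsto_natCast_atTop_atTop)).sub
      (tendsto_finsetSum _ fun j _ => ?_)).norm
    exact (((ht j).comp tendsto_natCast_atTop_atTop).const_sub _).const_mul _
  simp only [sub_zero] at hlim
  refine le_of_tendsto hlim (Eventually.of_forall fun n => (hfin n).trans ?_)
  refine mul_le_mul_of_nonneg_left ?_ hb0
  rw [intervalIntegral.integral_of_le n.cast_nonneg]
  exact setIntegral_mono_set (hi _).norm (ae_of_all _ fun _ => norm_nonneg _)
    (Set.Ioc_subset_Ioi_self.eventuallyLE)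

end

section

variable {X : Type*} [NormedAddCommGroup X] [InnerProductSpace ℝ X]

/-! ### Weights -/

/-- The weight `(1 + ‖x‖)^{-m}`. -/
def wt (m : ℕ) (x : X) : ℝ := ((1 + ‖x‖) ^ m)⁻¹

theorem wt_pos (m : ℕ) (x : X) : 0 < wt m x := by unfold wt; positivity

theorem wt_zero (x : X) : wt 0 x = 1 := by simp [wt]

theorem continuous_wt (m : ℕ) : Continuous (wt m : X → ℝ) := by
  unfold wt
  exact Continuous.inv₀ (by fun_prop) fun x => by positivity

theorem wt_anti {m n : ℕ} (h : m ≤ n) (x : X) : wt n x ≤ wt m x := by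
  unfold wt
  exact inv_anti₀ (by positivity) (pow_le_pow_right₀ (by linarith [norm_nonneg x]) h)

theorem SchwartzMap.exists_le_wt (φ : 𝓢(X, ℂ)) (m : ℕ) :
    ∃ D : ℝ, 0 ≤ D ∧ ∀ x, ‖φ x‖ ≤ D * wt m x := by
  refine ⟨2 ^ m * (Finset.Iic (m, 0)).sup (fun m => SchwartzMap.seminorm ℝ m.1 m.2) φ,
    by positivity, fun x => ?_⟩
  have h := SchwartzMap.one_add_le_sup_seminorm_apply (𝕜 := ℝ) (m := (m, 0)) (k := m) (n := 0)
    le_rfl le_rfl φ x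
  rw [norm_iteratedFDeriv_zero] at h
  rw [wt, ← div_eq_mul_inv, le_div_iff₀' (by positivity)]
  exact h

/-- A closed salient convex cone, described by a linear form which dominates the norm. -/
structure IsSalient (C : Set X) : Prop where
  zero_mem : (0 : X) ∈ C
  add_mem : ∀ x ∈ C, ∀ y ∈ C, x + y ∈ C
  smul_mem : ∀ t : ℝ, 0 ≤ t → ∀ x ∈ C, t • x ∈ C
  isClosed : IsClosed C
  exists_form : ∃ l : X →L[ℝ] ℝ, ∀ x ∈ C, ‖x‖ ≤ l x

/-- The form `l` dominates the norm on `C` and is additive, so `‖x‖` and `‖y‖` are each bounded by a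
multiple of `‖x + y‖`. Spending half of the exponent on each summand therefore splits decay of `x +
y` into a product, which is the form needed for iterated integrals. -/
theorem IsSalient.exists_wt_add {C : Set X} (hC : IsSalient C) : ∃ κ : ℝ, 1 ≤ κ ∧
    ∀ m : ℕ, ∀ x ∈ C, ∀ y ∈ C, wt (m + m) (x + y) ≤ κ ^ (m + m) * (wt m x * wt m y) ∧
      wt m (x + y) ≤ κ ^ m * wt m x := by
  obtain ⟨l, hl⟩ := hC.exists_form
  have h1 : ∀ x ∈ C, ∀ y ∈ C, 1 + ‖x‖ ≤ (1 + ‖l‖) * (1 + ‖x + y‖) := by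
    intro x hx y hy
    have h2 : ‖x‖ ≤ ‖l‖ * ‖x + y‖ := by
      calc ‖x‖ ≤ l x := hl x hx
        _ ≤ l x + l y := by linarith [hl y hy, norm_nonneg y]
        _ = l (x + y) := (map_add l x y).symm
        _ ≤ ‖l (x + y)‖ := Real.le_norm_self _
        _ ≤ _ := l.le_opNorm _
    nlinarith [norm_nonneg l, norm_nonneg (x + y)]
  have h3 : ∀ m : ℕ, ∀ x ∈ C, ∀ y ∈ C, wt m (x + y) ≤ (1 + ‖l‖) ^ m * wt m x := by
    intro m x hx y hy
    have h4 := pow_le_pow_left₀ (by positivity) (h1 x hx y hy) m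
    rw [mul_pow] at h4
    unfold wt
    rw [← div_eq_mul_inv, le_div_iff₀ (by positivity), inv_mul_le_iff₀ (by positivity)]
    linarith
  refine ⟨1 + ‖l‖, by linarith [norm_nonneg l], fun m x hx y hy => ⟨?_, h3 m x hx y hy⟩⟩
  have hadd : wt (m + m) (x + y) = wt m (x + y) * wt m (x + y) := by
    unfold wt; rw [pow_add, mul_inv]
  have h5 := h3 m y hy x hx
  rw [add_comm y x] at h5
  rw [hadd, pow_add]
  calc _ ≤ ((1 + ‖l‖) ^ m * wt m x) * ((1 + ‖l‖) ^ m * wt m y) :=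
        mul_le_mul (h3 m x hx y hy) h5 (wt_pos _ _).le (by have := wt_pos m x; positivity)
    _ = _ := by ring

/-! ### Measures with bounded weighted mass -/

/-- `κ` lives on the half line `t ≥ 0` and `∫ (1 + t)^{-2} dκ ≤ b`. -/
structure HalfLineBound (κ : Measure ℝ) (b : ℝ≥0) : Prop where
  nonneg : ∀ᵐ t ∂κ, 0 ≤ t
  bound : ∫⁻ t, ENNReal.ofReal (((1 + |t|) ^ 2)⁻¹) ∂κ ≤ b

/-- `μ` lives on `C` and `∫ (1 + ‖x‖)^{-p} dμ ≤ b`. -/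
structure ConeBound [MeasurableSpace X] (C : Set X) (μ : Measure X) (p : ℕ) (b : ℝ≥0) : Prop where
  mem : ∀ᵐ x ∂μ, x ∈ C
  bound : ∫⁻ x, ENNReal.ofReal (wt p x) ∂μ ≤ b

theorem exists_wt_smul_le {v : X} (hv : v ≠ 0) : ∃ κ : ℝ, 0 ≤ κ ∧ ∀ t : ℝ,
    wt 2 (t • v) ≤ κ * ((1 + |t|) ^ 2)⁻¹ := by
  have hv' : 0 < ‖v‖ := norm_pos_iff.2 hv
  refine ⟨(1 + ‖v‖⁻¹) ^ 2, by positivity, fun t => ?_⟩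
  have h1 : 1 + |t| ≤ (1 + ‖v‖⁻¹) * (1 + ‖t • v‖) := by
    rw [norm_smul, Real.norm_eq_abs]
    have : ‖v‖⁻¹ * (|t| * ‖v‖) = |t| := by field_simp
    nlinarith [abs_nonneg t, inv_pos.2 hv', mul_nonneg (abs_nonneg t) hv'.le]
  have h2 := pow_le_pow_left₀ (by positivity) h1 2
  rw [mul_pow] at h2
  unfold wt
  rw [← div_eq_mul_inv, le_div_iff₀ (by positivity), inv_mul_le_iff₀ (by positivity)]
  linarith

section ConeBound

variable [MeasurableSpace X] [BorelSpace X] {C : Set X} {μ : Measure X} {p : ℕ} {b : ℝ≥0}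

theorem ConeBound.mono (h : ConeBound C μ p b) {q : ℕ} (hpq : p ≤ q) : ConeBound C μ q b :=
  ⟨h.mem, (lintegral_mono fun x => ENNReal.ofReal_le_ofReal (wt_anti hpq x)).trans h.bound⟩

theorem ConeBound.integrable_wt (h : ConeBound C μ p b) : Integrable (wt p) μ := by
  refine ⟨(continuous_wt p).measurable.aestronglyMeasurable, ?_⟩
  rw [hasFiniteIntegral_iff_ofReal (ae_of_all _ fun x => (wt_pos p x).le)]
  exact h.bound.trans_lt ENNReal.coe_lt_top

theorem ConeBound.integral_wt_le (h : ConeBound C μ p b) : ∫ x, wt p x ∂μ ≤ b := by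
  rw [integral_eq_lintegral_of_nonneg_ae (ae_of_all _ fun x => (wt_pos p x).le)
    (continuous_wt p).measurable.aestronglyMeasurable]
  exact ENNReal.toReal_le_coe_of_le_coe h.bound

theorem ConeBound.integrable (h : ConeBound C μ p b) {f : X → ℂ} (hf : AEStronglyMeasurable f μ)
    {D : ℝ} (hD : ∀ x ∈ C, ‖f x‖ ≤ D * wt p x) : Integrable f μ :=
  (h.integrable_wt.const_mul D).mono' hf (h.mem.mono hD)

theorem ConeBound.norm_integral_le (h : ConeBound C μ p b) {f : X → ℂ}
    {D : ℝ} (hD0 : 0 ≤ D) (hD : ∀ x ∈ C, ‖f x‖ ≤ D * wt p x) : ‖∫ x, f x ∂μ‖ ≤ D * b := by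
  refine (norm_integral_le_of_norm_le (h.integrable_wt.const_mul D) (h.mem.mono hD)).trans ?_
  rw [integral_const_mul]
  exact mul_le_mul_of_nonneg_left h.integral_wt_le hD0

/-- Bound for translates: decay of order `2 m` is turned into decay of order `m`. -/
theorem IsSalient.exists_norm_integral_translate_le (hC : IsSalient C) (p m : ℕ) (b : ℝ≥0) :
    ∃ (q : ℕ) (B : ℝ), 0 ≤ B ∧ ∀ μ : Measure X, ConeBound C μ p b → ∀ f : X → ℂ, ∀ D : ℝ, 0 ≤ D →
      (∀ x ∈ C, ‖f x‖ ≤ D * wt q x) → ∀ y ∈ C,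
        ‖∫ x, f (y + x) ∂μ‖ ≤ B * D * wt m y ∧
        (AEStronglyMeasurable (fun x => f (y + x)) μ → Integrable (fun x => f (y + x)) μ) := by
  obtain ⟨κ, hκ, h⟩ := hC.exists_wt_add
  -- Of the two copies of the weight of order `r`, the one in `x` is integrable because `r ≥ p`, and
  -- the one in `y` is left over because `r ≥ m`.
  set r := max p m with hr
  refine ⟨r + r, κ ^ (r + r) * b, by positivity, fun μ hμ f D hD hf y hy => ?_⟩
  have hμ' := hμ.mono (le_max_left p m)
  have hb : ∀ x ∈ C, ‖f (y + x)‖ ≤ (D * κ ^ (r + r) * wt m y) * wt r x := by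
    intro x hx
    refine (hf _ (hC.add_mem y hy x hx)).trans ?_
    calc D * wt (r + r) (y + x) ≤ D * (κ ^ (r + r) * (wt r y * wt r x)) :=
          mul_le_mul_of_nonneg_left (h r y hy x hx).1 hD
      _ ≤ D * (κ ^ (r + r) * (wt m y * wt r x)) := by
          have := wt_anti (le_max_right p m) y
          have := (wt_pos r x).le
          gcongr
      _ = _ := by ring
  have h0 : 0 ≤ D * κ ^ (r + r) * wt m y := by have := (wt_pos m y).le; positivity
  refine ⟨(hμ'.norm_integral_le h0 hb).trans (le_of_eq (by ring)), fun hm =>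
    hμ'.integrable hm hb⟩

end ConeBound

end

section

variable {X : Type*} [NormedAddCommGroup X] [InnerProductSpace ℝ X] [FiniteDimensional ℝ X]
  [MeasurableSpace X] [BorelSpace X]

/-! ### Product measures on cones -/

/-- The image of the product measure `∏_{a ∈ A} κ` under `t ↦ ∑ t_a a`. -/
def coneMeasure (κ : Measure ℝ) (A : Finset X) : Measure X :=
  (Measure.pi fun _ : A => κ).map fun t => ∑ a : A, t a • (a : X)

theorem coneMeasure_empty (κ : Measure ℝ) : coneMeasure κ (∅ : Finset X) = Measure.dirac 0 := by
  have h : (Measure.pi fun _ : (∅ : Finset X) => κ) = Measure.dirac (fun a => 0) := by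
    rw [Measure.pi_of_empty (x := fun a => 0)]
  rw [coneMeasure, h, Measure.map_dirac' (by fun_prop)]
  simp

instance (κ : Measure ℝ) [SigmaFinite κ] (A : Finset X) : SFinite (coneMeasure κ A) := by
  unfold coneMeasure; infer_instance

-- Splitting off one factor of the product measure is what permits induction on the number of
-- generators.
open Classical in
theorem coneMeasure_insert (κ : Measure ℝ) [SigmaFinite κ] {A : Finset X} {v : X} (hv : v ∉ A) :
    coneMeasure κ (insert v A) =
      (κ.prod (coneMeasure κ A)).map fun p : ℝ × X => p.1 • v + p.2 := by
  have hd : Disjoint ({v} : Finset X) A := Finset.disjoint_singleton_left.2 hv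
  have h1 : (κ.prod (coneMeasure κ A)) =
      ((Measure.pi fun _ : ({v} : Finset X) => κ).prod (Measure.pi fun _ : A => κ)).map
        (Prod.map (fun t => t ⟨v, by simp⟩) fun t => ∑ a : A, t a • (a : X)) := by
    rw [← Measure.map_prod_map _ _ (by fun_prop) (by fun_prop), coneMeasure]
    congr 1
    exact (measurePreserving_piUnique (fun _ : ({v} : Finset X) => κ)).map_eq.symm
  rw [h1, Measure.map_map (by fun_prop) (by fun_prop), Finset.insert_eq, coneMeasure,
    ← (measurePreserving_piFinsetUnion hd fun _ => κ).map_eq, Measure.map_map (by fun_prop)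
      (MeasurableEquiv.measurable _)]
  congr 1
  funext ⟨f, g⟩
  simp only [Function.comp_apply, Prod.map_apply]
  rw [← (Equiv.Finset.union _ _ hd).sum_comp, Fintype.sum_sum_type]
  congr 1
  · rw [Fintype.sum_unique]
    exact congrArg (· • v) (Equiv.piFinsetUnion_left (fun _ => ℝ) hd (f := f) (g := g)
      (Finset.mem_singleton_self v) (by simp))
  · refine Finset.sum_congr rfl fun a _ => ?_
    exact congrArg (· • (a : X)) (Equiv.piFinsetUnion_right (fun _ => ℝ) hd (f := f) (g := g)
      a.2 (by simp))

/-- The weight of `t • v + x` is split by salience, and half of it is traded for decay of order two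
in `t`. The new exponent and constant are chosen before the measures, which gives uniformity in `N`
when applied to sampling measures. -/
theorem ConeBound.map_prod {C : Set X} (hC : IsSalient C) {v : X} (hv : v ∈ C) (hv0 : v ≠ 0)
    (p : ℕ) (b B : ℝ≥0) : ∃ (q : ℕ) (B' : ℝ≥0), ∀ (κ : Measure ℝ) (μ : Measure X) [SFinite κ]
      [SFinite μ], HalfLineBound κ b → ConeBound C μ p B →
      ConeBound C ((κ.prod μ).map fun p : ℝ × X => p.1 • v + p.2) q B' := by
  obtain ⟨k, hk1, hk⟩ := hC.exists_wt_add
  obtain ⟨c, hc0, hc⟩ := exists_wt_smul_le hv0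
  set r := max p 2 with hr
  refine ⟨r + r, Real.toNNReal (k ^ (r + r) * c) * (b * B), fun κ μ _ _ hκ hμ => ?_⟩
  have hμ' := hμ.mono (le_max_left p 2)
  have hmem : ∀ᵐ z ∂κ.prod μ, 0 ≤ z.1 ∧ z.2 ∈ C :=
    (Measure.quasiMeasurePreserving_fst.ae hκ.nonneg).and
      (Measure.quasiMeasurePreserving_snd.ae hμ.mem)
  have hle : ∀ᵐ z ∂κ.prod μ, ENNReal.ofReal (wt (r + r) (z.1 • v + z.2)) ≤
      ENNReal.ofReal (k ^ (r + r) * c) *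
        (ENNReal.ofReal (((1 + |z.1|) ^ 2)⁻¹) * ENNReal.ofReal (wt r z.2)) := by
    refine hmem.mono fun z hz => ?_
    rw [← ENNReal.ofReal_mul (by positivity), ← ENNReal.ofReal_mul (by positivity)]
    refine ENNReal.ofReal_le_ofReal ((hk r _ (hC.smul_mem _ hz.1 _ hv) _ hz.2).1.trans ?_)
    have h1 := (wt_anti (le_max_right p 2) (z.1 • v)).trans (hc z.1)
    have h2 := (wt_pos r z.2).le
    calc _ ≤ k ^ (r + r) * (c * ((1 + |z.1|) ^ 2)⁻¹ * wt r z.2) := by gcongr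
      _ = _ := by ring
  have hm : Measurable fun p : ℝ × X => p.1 • v + p.2 := by fun_prop
  have hmt : Measurable fun t : ℝ => ENNReal.ofReal (((1 + |t|) ^ 2)⁻¹) := by fun_prop
  have hmw : Measurable fun x : X => ENNReal.ofReal (wt r x) :=
    (continuous_wt r).measurable.ennreal_ofReal
  refine ⟨?_, ?_⟩
  · have h1 : ∀ᵐ z ∂κ.prod μ, z.1 • v + z.2 ∈ C := hmem.mono fun z hz =>
      hC.add_mem _ (hC.smul_mem _ hz.1 _ hv) _ hz.2
    exact (ae_map_iff hm.aemeasurable hC.isClosed.measurableSet).2 h1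
  · rw [lintegral_map (continuous_wt _).measurable.ennreal_ofReal hm]
    refine (lintegral_mono_ae hle).trans ?_
    rw [lintegral_const_mul' _ _ ENNReal.ofReal_ne_top,
      lintegral_prod_mul hmt.aemeasurable hmw.aemeasurable, ENNReal.coe_mul, ENNReal.coe_mul]
    exact mul_le_mul' le_rfl (mul_le_mul' hκ.bound hμ'.bound)

/-- The cone measures of all finite subsets of a salient cone have uniformly bounded weighted
mass. -/
theorem exists_coneBound_coneMeasure {C : Set X} (hC : IsSalient C) (b : ℝ≥0) (A : Finset X)
    (hA : ∀ a ∈ A, a ∈ C ∧ a ≠ 0) : ∃ (p : ℕ) (B : ℝ≥0), ∀ (κ : Measure ℝ) [SigmaFinite κ],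
      HalfLineBound κ b → ConeBound C (coneMeasure κ A) p B := by
  classical
  induction A using Finset.induction_on with
  | empty =>
    refine ⟨0, 1, fun κ _ _ => ?_⟩
    rw [coneMeasure_empty]
    refine ⟨?_, by simp [wt_zero]⟩
    exact (ae_dirac_iff hC.isClosed.measurableSet).2 hC.zero_mem
  | insert v A hv ih =>
    obtain ⟨p, B, h⟩ := ih fun a ha => hA a (Finset.mem_insert_of_mem ha)
    obtain ⟨hvC, hv0⟩ := hA v (Finset.mem_insert_self v A)
    obtain ⟨q, B', h'⟩ := ConeBound.map_prod hC hvC hv0 p b B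
    refine ⟨q, B', fun κ _ hκ => ?_⟩
    rw [coneMeasure_insert κ hv]
    exact h' κ _ hκ (h κ hκ)

/-! ### Lebesgue measure and sampling measures on the half line -/

/-- Lebesgue measure on the half line. -/
def halfLine : Measure ℝ := volume.restrict (Set.Ioi 0)

instance : SigmaFinite halfLine := by unfold halfLine; infer_instance

/-- The measure `N^{-1} ∑_{k ≥ 0} δ_{k/N}`. -/
def sampling (N : ℕ) : Measure ℝ :=
  ((N : ℝ≥0)⁻¹ • (Measure.count : Measure ℕ)).map fun k : ℕ => (k : ℝ) / N

theorem sigmaFinite_sampling {N : ℕ} (hN : 0 < N) : SigmaFinite (sampling N) := by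
  have hN' : (N : ℝ) ≠ 0 := by positivity
  have hinj : Function.Injective fun k : ℕ => (k : ℝ) / N := fun k l h => by
    simpa [div_left_inj' hN'] using h
  exact (measurable_from_nat.measurableEmbedding hinj).sigmaFinite_map

theorem halfLineBound_halfLine : ∃ b : ℝ≥0, HalfLineBound halfLine b := by
  have hi : Integrable (fun t : ℝ => ((1 + |t|) ^ 2)⁻¹) := by
    refine integrable_inv_one_add_sq.mono' (by fun_prop) (ae_of_all _ fun t => ?_)
    rw [Real.norm_of_nonneg (by positivity)]
    refine inv_anti₀ (by positivity) ?_
    nlinarith [abs_nonneg t, sq_abs t]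
  refine ⟨(∫⁻ t, ENNReal.ofReal (((1 + |t|) ^ 2)⁻¹) ∂halfLine).toNNReal, ?_, ?_⟩
  · exact (ae_restrict_mem measurableSet_Ioi).mono fun t ht => le_of_lt ht
  · rw [ENNReal.coe_toNNReal]
    have h := (hi.mono_measure (Measure.restrict_le_self (s := Set.Ioi 0))).2
    rw [hasFiniteIntegral_iff_ofReal (ae_of_all _ fun t => by positivity)] at h
    exact h.ne

/-- The mass at `k / N` contributes `N / (N + k)²`, and `∑_{i ≥ N} i⁻² ≤ 2 / N`. So the constant `2`
serves all `N` at once. -/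
theorem halfLineBound_sampling {N : ℕ} (hN : 0 < N) : HalfLineBound (sampling N) 2 := by
  have hm : Measurable fun k : ℕ => (k : ℝ) / N := measurable_from_nat
  have hN' : (0 : ℝ) < N := by positivity
  refine ⟨?_, ?_⟩
  · exact (ae_map_iff hm.aemeasurable measurableSet_Ici).2 (ae_of_all _ fun k => by
      exact div_nonneg k.cast_nonneg N.cast_nonneg)
  · rw [sampling, lintegral_map (by fun_prop) hm, lintegral_smul_measure, lintegral_count,
      ENNReal.smul_def, smul_eq_mul, ← ENNReal.tsum_mul_left]
    refine ENNReal.tsum_le_of_sum_range_le fun n => ?_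
    have h1 : ∀ k : ℕ, (((N : ℝ≥0)⁻¹ : ℝ≥0) : ENNReal) *
        ENNReal.ofReal (((1 + |(k : ℝ) / N|) ^ 2)⁻¹) =
        ENNReal.ofReal (N * (((N + k : ℕ) : ℝ) ^ 2)⁻¹) := by
      intro k
      rw [← ENNReal.ofReal_coe_nnreal, ← ENNReal.ofReal_mul (by positivity)]
      congr 1
      rw [abs_of_nonneg (by positivity)]
      push_cast
      field_simp
    rw [Finset.sum_congr rfl fun k _ => h1 k, ← ENNReal.ofReal_sum_of_nonneg
      fun k _ => by positivity, ← Finset.mul_sum]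
    have h2 : ∑ k ∈ Finset.range n, (((N + k : ℕ) : ℝ) ^ 2)⁻¹ =
        ∑ i ∈ Finset.Ioo (N - 1) (N + n), ((i : ℝ) ^ 2)⁻¹ := by
      have h3 : Finset.Ioo (N - 1) (N + n) = Finset.Ico N (N + n) := by
        ext i; simp only [Finset.mem_Ioo, Finset.mem_Ico]; lia
      rw [h3, Finset.sum_Ico_eq_sum_range, Nat.add_sub_cancel_left]
    have h4 := sum_Ioo_inv_sq_le (α := ℝ) (N - 1) (N + n)
    rw [h2, show ((2 : ℝ≥0) : ENNReal) = ENNReal.ofReal 2 by simp]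
    refine ENNReal.ofReal_le_ofReal ?_
    rw [Nat.cast_sub hN, Nat.cast_one, sub_add_cancel] at h4
    calc _ ≤ (N : ℝ) * (2 / N) := mul_le_mul_of_nonneg_left h4 hN'.le
      _ = 2 := by field_simp

theorem HalfLineBound.mono {κ : Measure ℝ} {b c : ℝ≥0} (h : HalfLineBound κ b) (hbc : b ≤ c) :
    HalfLineBound κ c :=
  ⟨h.nonneg, h.bound.trans (by exact_mod_cast hbc)⟩

theorem exists_halfLineBound : ∃ b : ℝ≥0, HalfLineBound halfLine b ∧
    ∀ N : ℕ, 0 < N → HalfLineBound (sampling N) b := by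
  obtain ⟨b, hb⟩ := halfLineBound_halfLine
  exact ⟨max b 2, hb.mono (le_max_left _ _), fun N hN =>
    (halfLineBound_sampling hN).mono (le_max_right _ _)⟩

end

/-! ### Integration against sampling measures and expansion along a ray. -/

section

theorem integrable_sampling_iff {N : ℕ} (hN : 0 < N) {f : ℝ → ℂ} (hf : Continuous f) :
    Integrable f (sampling N) ↔ Summable fun k : ℕ => f ((k : ℝ) / N) := by
  rw [sampling, integrable_map_measure hf.aestronglyMeasurable measurable_from_nat.aemeasurable]
  change Integrable _ ((((N : ℝ≥0)⁻¹ : ℝ≥0) : ENNReal) • Measure.count) ↔ _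
  rw [integrable_smul_measure (by simpa using hN.ne') (by simp), integrable_count_iff]
  exact summable_norm_iff

theorem integral_sampling {N : ℕ} (hN : 0 < N) {f : ℝ → ℂ} (hf : Continuous f)
    (hi : Integrable f (sampling N)) :
    ∫ t, f t ∂sampling N = (N : ℂ)⁻¹ * ∑' k : ℕ, f ((k : ℝ) / N) := by
  have hs := (integrable_sampling_iff hN hf).1 hi
  have hc : Integrable (fun k : ℕ => f ((k : ℝ) / N)) Measure.count :=
    integrable_count_iff.2 hs.norm
  rw [sampling, integral_map measurable_from_nat.aemeasurable hf.aestronglyMeasurable,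
    integral_smul_nnreal_measure, integral_countable hc]
  simp [measureReal_def, NNReal.smul_def]

variable {X : Type*} [NormedAddCommGroup X] [InnerProductSpace ℝ X] [FiniteDimensional ℝ X]
  [MeasurableSpace X] [BorelSpace X]

theorem hasDerivAt_line (φ : 𝓢(X, ℂ)) (z v : X) (t : ℝ) :
    HasDerivAt (fun t : ℝ => φ (z + t • v)) (dirDeriv v φ (z + t • v)) t := by
  have h1 : HasDerivAt (fun t : ℝ => z + t • v) v t := by
    simpa using ((hasDerivAt_id t).smul_const v).const_add z
  have h2 := (φ.differentiableAt (x := z + t • v)).hasFDerivAt.comp_hasDerivAt t h1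
  have h3 : dirDeriv v φ (z + t • v) = fderiv ℝ φ (z + t • v) v :=
    SchwartzMap.lineDerivOp_apply_eq_fderiv v φ (z + t • v)
  rw [h3]
  exact h2

/-- Provides the sequence of successive derivatives required by Euler–Maclaurin, with `a = N⁻¹` as
the rescaling of the ray. -/
theorem hasDerivAt_line_pow (φ : 𝓢(X, ℂ)) (z v : X) (a : ℝ) (j : ℕ) (t : ℝ) :
    HasDerivAt (fun t : ℝ => (a ^ j : ℝ) • (dirDeriv v ^ j) φ (z + (a * t) • v))
      ((a ^ (j + 1) : ℝ) • (dirDeriv v ^ (j + 1)) φ (z + (a * t) • v)) t := by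
  have h := ((hasDerivAt_line ((dirDeriv v ^ j) φ) z v (a * t)).scomp t
    ((hasDerivAt_id t).const_mul a)).const_smul (a ^ j : ℝ)
  refine h.congr_deriv ?_
  rw [pow_succ' (dirDeriv v), smul_smul, mul_one, pow_succ]
  rfl

/-- Decay along a ray in the cone. -/
theorem IsSalient.exists_line_bound {C : Set X} (hC : IsSalient C) {v : X} (hv : v ∈ C)
    (hv0 : v ≠ 0) (φ : 𝓢(X, ℂ)) (m : ℕ) : ∃ D : ℝ, 0 ≤ D ∧ ∀ z ∈ C, ∀ t : ℝ, 0 ≤ t →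
      ‖φ (z + t • v)‖ ≤ D * wt m z * ((1 + |t|) ^ 2)⁻¹ := by
  obtain ⟨k, hk1, hk⟩ := hC.exists_wt_add
  obtain ⟨c, hc0, hc⟩ := exists_wt_smul_le hv0
  set r := max m 2 with hr
  obtain ⟨D, hD0, hD⟩ := SchwartzMap.exists_le_wt φ (r + r)
  refine ⟨D * k ^ (r + r) * c, by positivity, fun z hz t ht => (hD _).trans ?_⟩
  have h1 := (wt_anti (le_max_right m 2) (t • v)).trans (hc t)
  have h2 := wt_anti (le_max_left m 2) z
  have h3 := (wt_pos m z).le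
  have h4 := (wt_pos r (t • v)).le
  calc D * wt (r + r) (z + t • v) ≤ D * (k ^ (r + r) * (wt r z * wt r (t • v))) :=
        mul_le_mul_of_nonneg_left (hk r z hz _ (hC.smul_mem t ht v hv)).1 hD0
    _ ≤ D * (k ^ (r + r) * (wt m z * (c * ((1 + |t|) ^ 2)⁻¹))) := by gcongr
    _ = _ := by ring

theorem HalfLineBound.integrable_of_bound {κ : Measure ℝ} {b : ℝ≥0} (h : HalfLineBound κ b)
    {f : ℝ → ℂ} (hf : AEStronglyMeasurable f κ) {D : ℝ}
    (hD : ∀ t, 0 ≤ t → ‖f t‖ ≤ D * ((1 + |t|) ^ 2)⁻¹) : Integrable f κ := by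
  have hi : Integrable (fun t : ℝ => ((1 + |t|) ^ 2)⁻¹) κ := by
    refine ⟨by fun_prop, ?_⟩
    rw [hasFiniteIntegral_iff_ofReal (ae_of_all _ fun t => by positivity)]
    exact h.bound.trans_lt ENNReal.coe_lt_top
  exact (hi.const_mul D).mono' hf (h.nonneg.mono hD)

theorem HalfLineBound.integral_norm_le {κ : Measure ℝ} {b : ℝ≥0} (h : HalfLineBound κ b)
    {f : ℝ → ℂ} {D : ℝ} (hD0 : 0 ≤ D)
    (hD : ∀ t, 0 ≤ t → ‖f t‖ ≤ D * ((1 + |t|) ^ 2)⁻¹) : ∫ t, ‖f t‖ ∂κ ≤ D * b := by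
  have hm : AEStronglyMeasurable (fun t : ℝ => ((1 + |t|) ^ 2)⁻¹) κ := by fun_prop
  have hi : Integrable (fun t : ℝ => ((1 + |t|) ^ 2)⁻¹) κ := by
    refine ⟨hm, ?_⟩
    rw [hasFiniteIntegral_iff_ofReal (ae_of_all _ fun t => by positivity)]
    exact h.bound.trans_lt ENNReal.coe_lt_top
  refine (integral_mono_of_nonneg (ae_of_all _ fun _ => norm_nonneg _) (hi.const_mul D)
    (h.nonneg.mono hD)).trans ?_
  rw [integral_const_mul]
  refine mul_le_mul_of_nonneg_left ?_ hD0
  rw [integral_eq_lintegral_of_nonneg_ae (ae_of_all _ fun t => by positivity) hm]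
  exact ENNReal.toReal_le_coe_of_le_coe h.bound

/-- Euler–Maclaurin expansion along a ray in the cone, uniformly in the starting point. -/
theorem eulerMaclaurin_line {C : Set X} (hC : IsSalient C) {v : X} (hv : v ∈ C)
    (hv0 : v ≠ 0) (φ : 𝓢(X, ℂ)) (K m : ℕ) : ∃ D : ℝ, 0 ≤ D ∧ ∀ N : ℕ, 0 < N → ∀ z ∈ C,
      ‖∫ t, φ (z + t • v) ∂sampling N - (∫ t, φ (z + t • v) ∂halfLine) -
        ∑ j ∈ Finset.range K,
          (emCoeff (j + 1) : ℂ) * ((N : ℂ) ^ (j + 1))⁻¹ * (dirDeriv v ^ j) φ z‖ ≤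
      D * ((N : ℝ) ^ (K + 1))⁻¹ * wt m z := by
  obtain ⟨b, hb0, hb⟩ := eulerMaclaurin_half_line K
  obtain ⟨β, hβ, hβ'⟩ := exists_halfLineBound
  have hbd : ∀ j, ∃ D : ℝ, 0 ≤ D ∧ ∀ z ∈ C, ∀ t : ℝ, 0 ≤ t →
      ‖(dirDeriv v ^ j) φ (z + t • v)‖ ≤ D * wt m z * ((1 + |t|) ^ 2)⁻¹ := fun j =>
    hC.exists_line_bound hv hv0 _ m
  choose D hD0 hD using hbd
  refine ⟨b * (D (K + 1) * β) + ‖(emCoeff (K + 1) : ℂ)‖ * D K,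
    by have := hD0 (K + 1); have := hD0 K; positivity, fun N hN z hz => ?_⟩
  have hN' : (0 : ℝ) < N := by positivity
  have hNC : (N : ℂ) ≠ 0 := by exact_mod_cast hN.ne'
  have hNi : (0 : ℝ) < (N : ℝ)⁻¹ := by positivity
  have hcont : ∀ j, Continuous fun t : ℝ => (dirDeriv v ^ j) φ (z + t • v) := fun j =>
    ((dirDeriv v ^ j) φ).continuous.comp (by fun_prop)
  have hcont0 : Continuous fun t : ℝ => φ (z + t • v) := hcont 0
  have hint : ∀ j, IntegrableOn (fun t : ℝ => (dirDeriv v ^ j) φ (z + t • v)) (Set.Ioi 0) :=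
    fun j => hβ.integrable_of_bound (hcont j).aestronglyMeasurable (hD j z hz)
  -- The ray is stretched by `N`, so that the points `k / N` become integers and the `j`-th
  -- derivative gains `N^{-j}`.
  set g : ℕ → ℝ → ℂ := fun j t =>
    ((N : ℝ)⁻¹ ^ j : ℝ) • (dirDeriv v ^ j) φ (z + ((N : ℝ)⁻¹ * t) • v) with hg
  have hsam : Integrable (fun t : ℝ => φ (z + t • v)) (sampling N) :=
    (hβ' N hN).integrable_of_bound hcont0.aestronglyMeasurable (hD 0 z hz)
  have hsum : Summable fun k : ℕ => g 0 k := by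
    have h := (integrable_sampling_iff hN hcont0).1 hsam
    refine h.congr fun k => ?_
    simp [hg, div_eq_inv_mul]
  have htend : ∀ j, Tendsto (g j) atTop (𝓝 0) := by
    intro j
    have h1 : Tendsto (fun t : ℝ => (dirDeriv v ^ j) φ (z + t • v)) atTop (𝓝 0) := by
      have h3 : Tendsto (fun t : ℝ => (1 + |t|) ^ 2) atTop atTop :=
        (tendsto_pow_atTop (by norm_num)).comp
          (tendsto_atTop_add_const_left _ _ tendsto_abs_atTop_atTop)
      have h2 : Tendsto (fun t : ℝ => D j * wt m z * ((1 + |t|) ^ 2)⁻¹) atTop (𝓝 0) := by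
        simpa using h3.inv_tendsto_atTop.const_mul (D j * wt m z)
      exact squeeze_zero_norm' ((eventually_ge_atTop 0).mono fun t ht => hD j z hz t ht) h2
    have h4 := (h1.comp (tendsto_id.const_mul_atTop hNi)).const_smul ((N : ℝ)⁻¹ ^ j : ℝ)
    rw [smul_zero] at h4
    exact h4
  have hgint : ∀ j, IntegrableOn (g j) (Set.Ioi 0) := by
    intro j
    have h := (integrableOn_Ioi_comp_mul_left_iff
      (fun t : ℝ => (dirDeriv v ^ j) φ (z + t • v)) 0 hNi).2
    rw [mul_zero] at h
    exact (h (hint j)).smul ((N : ℝ)⁻¹ ^ j : ℝ)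
  have hmain := hb g (fun j t => hasDerivAt_line_pow φ z v _ j t) hgint htend hsum
  have hi0 : (∫ t in Set.Ioi (0 : ℝ), g 0 t) = N * ∫ t, φ (z + t • v) ∂halfLine := by
    have h := integral_comp_mul_left_Ioi (fun t : ℝ => φ (z + t • v)) 0 hNi
    rw [mul_zero, inv_inv] at h
    simp only [hg, pow_zero, one_smul]
    refine h.trans ?_
    simp [halfLine]
  have hs0 : ∑' k : ℕ, g 0 k = N * ∫ t, φ (z + t • v) ∂sampling N := by
    rw [integral_sampling hN hcont0 hsam, mul_inv_cancel_left₀ hNC]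
    refine tsum_congr fun k => ?_
    simp [hg, div_eq_inv_mul]
  have hiK : (∫ t in Set.Ioi (0 : ℝ), ‖g (K + 1) t‖) ≤
      N * ((N : ℝ) ^ (K + 1))⁻¹ * (D (K + 1) * wt m z * β) := by
    have h := integral_comp_mul_left_Ioi
      (fun t : ℝ => ‖(dirDeriv v ^ (K + 1)) φ (z + t • v)‖) 0 hNi
    rw [mul_zero, inv_inv] at h
    have h2 : ∀ t, ‖g (K + 1) t‖ = ((N : ℝ) ^ (K + 1))⁻¹ *
        ‖(dirDeriv v ^ (K + 1)) φ (z + ((N : ℝ)⁻¹ * t) • v)‖ := fun t => by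
      simp only [hg]
      rw [norm_smul, Real.norm_of_nonneg (by positivity), inv_pow]
    simp only [h2]
    rw [integral_const_mul, h, smul_eq_mul, mul_left_comm, ← mul_assoc]
    refine mul_le_mul_of_nonneg_left ?_ (by positivity)
    exact hβ.integral_norm_le (mul_nonneg (hD0 _) (wt_pos _ _).le) (hD (K + 1) z hz)
  -- The half line formula carries one boundary term more than wanted. That term, `j = K`, has the
  -- same order as the remainder and is absorbed into it.
  rw [hs0, hi0, Finset.sum_range_succ] at hmain
  have hlast : ‖g K 0‖ ≤ ((N : ℝ) ^ K)⁻¹ * (D K * wt m z) := by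
    simp only [hg]
    rw [norm_smul, Real.norm_of_nonneg (by positivity), inv_pow]
    refine mul_le_mul_of_nonneg_left ?_ (by positivity)
    simpa using hD K z hz 0 le_rfl
  set S := ∫ t, φ (z + t • v) ∂sampling N
  set I := ∫ t, φ (z + t • v) ∂halfLine
  have hsumeq : ∑ j ∈ Finset.range K, (emCoeff (j + 1) : ℂ) * g j 0 =
      N * ∑ j ∈ Finset.range K,
          (emCoeff (j + 1) : ℂ) * ((N : ℂ) ^ (j + 1))⁻¹ * (dirDeriv v ^ j) φ z := by
    rw [Finset.mul_sum]
    refine Finset.sum_congr rfl fun j _ => ?_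
    simp only [hg, mul_zero, zero_smul, add_zero, Complex.real_smul, inv_pow]
    push_cast
    rw [pow_succ]
    field_simp
  rw [hsumeq] at hmain
  set T := ∑ j ∈ Finset.range K,
          (emCoeff (j + 1) : ℂ) * ((N : ℂ) ^ (j + 1))⁻¹ * (dirDeriv v ^ j) φ z
  have hfin : (N : ℝ) * ‖S - I - T‖ ≤ b * (N * ((N : ℝ) ^ (K + 1))⁻¹ * (D (K + 1) * wt m z * β)) +
      ‖(emCoeff (K + 1) : ℂ)‖ * (((N : ℝ) ^ K)⁻¹ * (D K * wt m z)) := by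
    have h1 : (N : ℂ) * (S - I - T) = (N * S - N * I - (N * T + (emCoeff (K + 1) : ℂ) * g K 0)) +
        (emCoeff (K + 1) : ℂ) * g K 0 := by ring
    have h2 : (N : ℝ) * ‖S - I - T‖ = ‖(N : ℂ) * (S - I - T)‖ := by
      rw [norm_mul, Complex.norm_natCast]
    rw [h2, h1]
    refine (norm_add_le _ _).trans (add_le_add ?_ ?_)
    · exact hmain.trans (mul_le_mul_of_nonneg_left hiK hb0)
    · rw [norm_mul]
      exact mul_le_mul_of_nonneg_left hlast (norm_nonneg _)
  rw [← mul_le_mul_iff_right₀ hN']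
  refine hfin.trans (le_of_eq ?_)
  rw [pow_succ]
  field_simp

end

section

variable {X : Type*} [NormedAddCommGroup X] [InnerProductSpace ℝ X]

/-! ### Iterated directional derivatives -/

/-- The operator `∏_{e ∈ α} ∇_e`. -/
def iterDeriv (α : Multiset X) : Op X := (α.toList.map dirDeriv).prod

theorem prod_dirDeriv_perm {l m : List X} (h : l.Perm m) :
    (l.map dirDeriv).prod = (m.map dirDeriv).prod := by
  induction h with
  | nil => rfl
  | cons e _ ih => simp only [List.map_cons, List.prod_cons, ih]
  | swap e f l =>
    simp only [List.map_cons, List.prod_cons, ← mul_assoc, dirDeriv_comm e f]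
  | trans _ _ h1 h2 => exact h1.trans h2

theorem iterDeriv_coe (l : List X) : iterDeriv (l : Multiset X) = (l.map dirDeriv).prod :=
  prod_dirDeriv_perm (Multiset.coe_eq_coe.1 (Multiset.coe_toList _))

theorem iterDeriv_zero : iterDeriv (0 : Multiset X) = 1 := by simp [iterDeriv]

theorem iterDeriv_add (α β : Multiset X) : iterDeriv (α + β) = iterDeriv α * iterDeriv β := by
  induction α using Quotient.inductionOn with | _ l
  induction β using Quotient.inductionOn with | _ m
  change iterDeriv ((l ++ m : List X) : Multiset X) =
    iterDeriv (l : Multiset X) * iterDeriv (m : Multiset X)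
  simp only [iterDeriv_coe, List.map_append, List.prod_append]

theorem iterDeriv_replicate (n : ℕ) (v : X) :
    iterDeriv (Multiset.replicate n v) = dirDeriv v ^ n := by
  rw [← Multiset.coe_replicate, iterDeriv_coe]
  simp

variable [FiniteDimensional ℝ X] [MeasurableSpace X] [BorelSpace X]

/-! ### Fubini -/

section Fubini

variable {C : Set X} {κ : Measure ℝ} {μ : Measure X} [SFinite κ] [SFinite μ] {b B : ℝ≥0} {p : ℕ}

theorem continuous_translate (φ : 𝓢(X, ℂ)) (y : X) : Continuous fun x => φ (y + x) :=
  φ.continuous.comp (by fun_prop)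

theorem ConeBound.integrable_translate (hC : IsSalient C) (hμ : ConeBound C μ p B) (φ : 𝓢(X, ℂ))
    {y : X} (hy : y ∈ C) : Integrable (fun x => φ (y + x)) μ := by
  obtain ⟨q, B', -, h⟩ := hC.exists_norm_integral_translate_le p 0 B
  obtain ⟨D, hD0, hD⟩ := SchwartzMap.exists_le_wt φ q
  exact (h μ hμ φ D hD0 (fun x _ => hD x) y hy).2
    (continuous_translate φ y).aestronglyMeasurable

/-- Joint integrability is pulled back from the image measure on the cone, whose weighted mass is
finite; this justifies all the uses of Fubini. -/
theorem integrable_prod_translate (hC : IsSalient C) {v : X} (hv : v ∈ C) (hv0 : v ≠ 0)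
    (hκ : HalfLineBound κ b) (hμ : ConeBound C μ p B) (φ : 𝓢(X, ℂ)) {y : X} (hy : y ∈ C) :
    Integrable (fun z : ℝ × X => φ (y + z.1 • v + z.2)) (κ.prod μ) := by
  obtain ⟨q, B', h⟩ := ConeBound.map_prod hC hv hv0 p b B
  have h1 := (h κ μ hκ hμ).integrable_translate hC φ hy
  rw [integrable_map_measure (continuous_translate φ y).aestronglyMeasurable
    (by fun_prop)] at h1
  refine h1.congr (ae_of_all _ fun z => ?_)
  simp [add_assoc]

theorem integral_map_prod_translate (hC : IsSalient C) {v : X} (hv : v ∈ C) (hv0 : v ≠ 0)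
    (hκ : HalfLineBound κ b) (hμ : ConeBound C μ p B) (φ : 𝓢(X, ℂ)) {y : X} (hy : y ∈ C) :
    ∫ x, φ (y + x) ∂((κ.prod μ).map fun p : ℝ × X => p.1 • v + p.2) =
      ∫ t, ∫ x, φ (y + t • v + x) ∂μ ∂κ := by
  rw [integral_map (by fun_prop) (continuous_translate φ y).aestronglyMeasurable,
    ← integral_prod _ (integrable_prod_translate hC hv hv0 hκ hμ φ hy)]
  simp [add_assoc]

theorem integral_integral_translate (hC : IsSalient C) {v : X} (hv : v ∈ C) (hv0 : v ≠ 0)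
    (hκ : HalfLineBound κ b) (hμ : ConeBound C μ p B) (φ : 𝓢(X, ℂ)) {y : X} (hy : y ∈ C) :
    ∫ t, ∫ x, φ (y + t • v + x) ∂μ ∂κ = ∫ x, ∫ t, φ (y + x + t • v) ∂κ ∂μ := by
  rw [integral_integral_swap (integrable_prod_translate hC hv hv0 hκ hμ φ hy)]
  refine integral_congr_ae (ae_of_all _ fun x => integral_congr_ae (ae_of_all _ fun t => ?_))
  simp only [add_right_comm]

end Fubini

open Classical in
theorem integral_coneMeasure_insert {C : Set X} (hC : IsSalient C) {A : Finset X}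
    (hA : ∀ a ∈ A, a ∈ C ∧ a ≠ 0) {v : X} (hv : v ∈ C) (hv0 : v ≠ 0) (hvA : v ∉ A)
    (κ : Measure ℝ) [SigmaFinite κ] {b : ℝ≥0} (hκ : HalfLineBound κ b)
    (φ : 𝓢(X, ℂ)) {y : X} (hy : y ∈ C) :
    ∫ x, φ (y + x) ∂coneMeasure κ (insert v A) =
      ∫ t, ∫ x, φ (y + t • v + x) ∂coneMeasure κ A ∂κ := by
  obtain ⟨p, B, h⟩ := exists_coneBound_coneMeasure hC b A hA
  rw [coneMeasure_insert κ hvA]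
  exact integral_map_prod_translate hC hv hv0 hκ (h κ hκ) φ hy

/-! ### The terms of the Euler–Maclaurin expansion on a cone -/

open Classical in
/-- The contribution of the multi-index `ν` to the Euler–Maclaurin expansion on the cone generated
by `A`, translated by `y`. -/
def emTerm (A : Finset X) (ν : X →₀ ℕ) (φ : 𝓢(X, ℂ)) (y : X) : ℂ :=
  ((∏ e ∈ ν.support, emCoeff (ν e) : ℝ) : ℂ) *
    ∫ x, iterDeriv (Finsupp.toMultiset ν - ν.support.val) φ (y + x)
      ∂coneMeasure halfLine (A \ ν.support)

open Classical in
/-- The coefficient of `N^{-n}` in the Euler–Maclaurin expansion on the cone generated by `A`. -/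
def emSum (A : Finset X) (n : ℕ) (φ : 𝓢(X, ℂ)) (y : X) : ℂ :=
  ∑ ν ∈ A.finsuppAntidiag n, emTerm A ν φ y

open Classical in
theorem sum_finsuppAntidiag_insert {A : Finset X} {v : X} (hv : v ∉ A) (n : ℕ)
    (F : (X →₀ ℕ) → ℂ) : ∑ ν ∈ (insert v A).finsuppAntidiag n, F ν =
      ∑ p ∈ Finset.HasAntidiagonal.antidiagonal n, ∑ ν ∈ A.finsuppAntidiag p.2, F (ν.update v p.1) := by
  have hvan : ∀ {k : ℕ} {ν : X →₀ ℕ}, ν ∈ A.finsuppAntidiag k → ν v = 0 := fun h =>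
    Finsupp.notMem_support_iff.1 fun h' => hv ((Finset.mem_finsuppAntidiag.1 h).2 h')
  rw [Finset.sum_sigma']
  symm
  refine Finset.sum_bij (fun p _ => p.2.update v p.1.1) ?_ ?_ ?_ (fun _ _ => rfl)
  · rintro ⟨p, ν⟩ hp
    rw [Finset.mem_sigma] at hp
    exact (Finset.mem_finsuppAntidiag_insert hv n).2 ⟨p, hp.1, ν, rfl, hp.2⟩
  · rintro ⟨⟨i, j⟩, ν⟩ hp ⟨⟨i', j'⟩, ν'⟩ hp' h
    simp only [Finset.mem_sigma, Finset.HasAntidiagonal.mem_antidiagonal] at hp hp' h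
    have hi : i = i' := by simpa using DFunLike.congr_fun h v
    have hν : ν = ν' := by
      ext x
      by_cases hx : x = v
      · rw [hx, hvan hp.2, hvan hp'.2]
      · simpa [Function.update_of_ne hx] using DFunLike.congr_fun h x
    have hj : j = j' := by lia
    subst hi hν hj
    rfl
  · intro ν hν
    obtain ⟨p, hp, g, rfl, hg⟩ := (Finset.mem_finsuppAntidiag_insert hv n).1 hν
    exact ⟨⟨p, g⟩, Finset.mem_sigma.2 ⟨hp, hg⟩, rfl⟩

-- A positive entry at `v` puts `v` in the support, so `v` is no longer a direction of integration.
-- One unit of the entry pays for the restriction to the boundary, and `j` derivatives remain.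
open Classical in
theorem emTerm_insert_update_succ {A : Finset X} {v : X} (hv : v ∉ A) {ν : X →₀ ℕ}
    (hν : ν.support ⊆ A) (j : ℕ) (φ : 𝓢(X, ℂ)) (y : X) :
    emTerm (insert v A) (ν.update v (j + 1)) φ y =
      (emCoeff (j + 1) : ℂ) * emTerm A ν ((dirDeriv v ^ j) φ) y := by
  have hvν : v ∉ ν.support := fun h => hv (hν h)
  have hs : (ν.update v (j + 1)).support = insert v ν.support :=
    Finsupp.support_update_ne_zero (f := ν) (a := v) (Nat.succ_ne_zero j)
  have hset : insert v A \ insert v ν.support = A \ ν.support := by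
    ext x
    simp only [Finset.mem_sdiff, Finset.mem_insert]
    by_cases hx : x = v
    · subst hx; simp [hv]
    · simp [hx]
  have hms : Finsupp.toMultiset (ν.update v (j + 1)) - (insert v ν.support).val =
      (Finsupp.toMultiset ν - ν.support.val) + Multiset.replicate j v := by
    ext x
    rw [Multiset.count_add, Multiset.count_sub, Multiset.count_sub, Finsupp.count_toMultiset,
      Finsupp.count_toMultiset, Multiset.count_replicate]
    by_cases hx : x = v
    · subst hx
      have h0 := Finsupp.notMem_support_iff.1 hvν
      have h1 : Multiset.count x (insert x ν.support).val = 1 :=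
        Multiset.count_eq_one_of_mem (Finset.nodup _) (by simp)
      rw [h0, h1]
      simp
    · have h1 : Multiset.count x (insert v ν.support).val = Multiset.count x ν.support.val := by
        rw [Multiset.count_eq_of_nodup (Finset.nodup _), Multiset.count_eq_of_nodup
          (Finset.nodup _)]
        simp [hx]
      rw [h1]
      simp [Function.update_of_ne hx, Ne.symm hx]
  have hprod : ∏ e ∈ insert v ν.support, emCoeff ((ν.update v (j + 1)) e) =
      emCoeff (j + 1) * ∏ e ∈ ν.support, emCoeff (ν e) := by
    rw [Finset.prod_insert hvν]
    congr 1
    · simp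
    · refine Finset.prod_congr rfl fun e he => ?_
      have : e ≠ v := fun h => hvν (h ▸ he)
      simp [Function.update_of_ne this]
  rw [emTerm, hs, hset, hms, hprod, iterDeriv_add, iterDeriv_replicate, emTerm]
  push_cast
  rw [mul_assoc]
  rfl

-- The complementary case of a zero entry at `v`: the generator stays a direction of integration.
open Classical in
theorem emTerm_insert {C : Set X} (hC : IsSalient C) {A : Finset X}
    (hA : ∀ a ∈ A, a ∈ C ∧ a ≠ 0) {v : X} (hvC : v ∈ C) (hv0 : v ≠ 0) (hv : v ∉ A)
    {ν : X →₀ ℕ} (hν : ν.support ⊆ A) (φ : 𝓢(X, ℂ)) {y : X} (hy : y ∈ C) :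
    emTerm (insert v A) ν φ y = ∫ t, emTerm A ν φ (y + t • v) ∂halfLine := by
  obtain ⟨b, hb, -⟩ := exists_halfLineBound
  have hvν : v ∉ ν.support := fun h => hv (hν h)
  have hset : insert v A \ ν.support = insert v (A \ ν.support) :=
    Finset.insert_sdiff_of_notMem A hvν
  simp only [emTerm]
  rw [hset, integral_coneMeasure_insert hC (fun a ha => hA a (Finset.mem_sdiff.1 ha).1) hvC hv0
    (fun h => hv (Finset.mem_sdiff.1 h).1) halfLine hb _ hy, integral_const_mul]

open Classical in
theorem integrable_emTerm {C : Set X} (hC : IsSalient C) {A : Finset X}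
    (hA : ∀ a ∈ A, a ∈ C ∧ a ≠ 0) {v : X} (hvC : v ∈ C) (hv0 : v ≠ 0)
    (ν : X →₀ ℕ) (φ : 𝓢(X, ℂ)) {y : X} (hy : y ∈ C) :
    Integrable (fun t : ℝ => emTerm A ν φ (y + t • v)) halfLine := by
  obtain ⟨b, hb, -⟩ := exists_halfLineBound
  obtain ⟨p, B, h⟩ := exists_coneBound_coneMeasure hC b (A \ ν.support)
    fun a ha => hA a (Finset.mem_sdiff.1 ha).1
  exact (integrable_prod_translate hC hvC hv0 hb (h _ hb) _ hy).integral_prod_left.const_mul _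

-- The coefficients obey the one-variable formula in each generator: splitting multi-indices by
-- their entry at `v`, zero gives the integral term and positive entries give the boundary terms.
open Classical in
theorem emSum_insert {C : Set X} (hC : IsSalient C) {A : Finset X}
    (hA : ∀ a ∈ A, a ∈ C ∧ a ≠ 0) {v : X} (hvC : v ∈ C) (hv0 : v ≠ 0) (hv : v ∉ A)
    (n : ℕ) (φ : 𝓢(X, ℂ)) {y : X} (hy : y ∈ C) :
    emSum (insert v A) n φ y = (∫ t, emSum A n φ (y + t • v) ∂halfLine) +
      ∑ j ∈ Finset.range n, (emCoeff (j + 1) : ℂ) * emSum A (n - (j + 1)) ((dirDeriv v ^ j) φ) y := by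
  have hsupp : ∀ {k : ℕ} {ν : X →₀ ℕ}, ν ∈ A.finsuppAntidiag k → ν.support ⊆ A := fun h =>
    (Finset.mem_finsuppAntidiag.1 h).2
  rw [emSum, sum_finsuppAntidiag_insert hv,
    Finset.Nat.sum_antidiagonal_eq_sum_range_succ
      (fun i k => ∑ ν ∈ A.finsuppAntidiag k, emTerm (insert v A) (ν.update v i) φ y),
    Finset.sum_range_succ', add_comm]
  congr 1
  · simp only [emSum, Nat.sub_zero]
    rw [integral_finsetSum _ fun ν _ => integrable_emTerm hC hA hvC hv0 ν φ hy]
    refine Finset.sum_congr rfl fun ν hν => ?_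
    rw [← emTerm_insert hC hA hvC hv0 hv (hsupp hν) φ hy]
    congr 1
    have h0 : ν v = 0 := Finsupp.notMem_support_iff.1 fun h' => hv (hsupp hν h')
    rw [← h0, Finsupp.update_self]
  · refine Finset.sum_congr rfl fun j _ => ?_
    rw [emSum, Finset.mul_sum]
    exact Finset.sum_congr rfl fun ν hν => emTerm_insert_update_succ hv (hsupp hν) j φ y

theorem integrable_emSum {C : Set X} (hC : IsSalient C) {A : Finset X}
    (hA : ∀ a ∈ A, a ∈ C ∧ a ≠ 0) {v : X} (hvC : v ∈ C) (hv0 : v ≠ 0)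
    (n : ℕ) (φ : 𝓢(X, ℂ)) {y : X} (hy : y ∈ C) :
    Integrable (fun t : ℝ => emSum A n φ (y + t • v)) halfLine :=
  integrable_finsetSum _ fun ν _ => integrable_emTerm hC hA hvC hv0 ν φ hy

open Classical in
theorem emSum_empty (n : ℕ) (φ : 𝓢(X, ℂ)) (y : X) :
    emSum ∅ n φ y = if n = 0 then φ y else 0 := by
  rw [emSum, Finset.finsuppAntidiag_empty]
  split_ifs with h
  · rw [Finset.sum_singleton, emTerm]
    simp [coneMeasure_empty, iterDeriv_zero]
  · simp

end

/-! ### The Euler–Maclaurin expansion on a cone. -/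

section

variable {X : Type*} [NormedAddCommGroup X] [InnerProductSpace ℝ X] [FiniteDimensional ℝ X]
  [MeasurableSpace X] [BorelSpace X]

theorem IsSalient.exists_norm_integral_line_le {C : Set X} (hC : IsSalient C) {v : X} (hv : v ∈ C)
    (hv0 : v ≠ 0) (m : ℕ) {κ : Measure ℝ} {b : ℝ≥0} (hκ : HalfLineBound κ b) :
    ∃ (q : ℕ) (B : ℝ), 0 ≤ B ∧ ∀ f : X → ℂ, ∀ D : ℝ, 0 ≤ D → (∀ z ∈ C, ‖f z‖ ≤ D * wt q z) →
      ∀ y ∈ C, ‖∫ t, f (y + t • v) ∂κ‖ ≤ B * D * wt m y := by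
  obtain ⟨k, hk1, hk⟩ := hC.exists_wt_add
  obtain ⟨c, hc0, hc⟩ := exists_wt_smul_le hv0
  set r := max m 2 with hr
  refine ⟨r + r, k ^ (r + r) * c * b, by positivity, fun f D hD0 hD y hy => ?_⟩
  have hb : ∀ t : ℝ, 0 ≤ t → ‖f (y + t • v)‖ ≤
      (D * k ^ (r + r) * c * wt m y) * ((1 + |t|) ^ 2)⁻¹ := by
    intro t ht
    have hz := hC.smul_mem t ht v hv
    refine (hD _ (hC.add_mem _ hy _ hz)).trans ?_
    have h1 := (wt_anti (le_max_right m 2) (t • v)).trans (hc t)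
    have h2 := wt_anti (le_max_left m 2) y
    have h3 := (wt_pos m y).le
    have h4 := (wt_pos r (t • v)).le
    calc D * wt (r + r) (y + t • v) ≤ D * (k ^ (r + r) * (wt r y * wt r (t • v))) :=
          mul_le_mul_of_nonneg_left (hk r y hy _ hz).1 hD0
      _ ≤ D * (k ^ (r + r) * (wt m y * (c * ((1 + |t|) ^ 2)⁻¹))) := by gcongr
      _ = _ := by ring
  have h3 := (wt_pos m y).le
  refine (norm_integral_le_integral_norm _).trans
    ((hκ.integral_norm_le (by positivity) hb).trans (le_of_eq (by ring)))

/-- A Cauchy product with `n = (j + 1) + k`: a boundary term of order `j + 1` in `v` needs only the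
first `K - j` terms of the expansion on the smaller cone. -/
theorem sum_emSum_reindex (v : X) (A : Finset X) (K : ℕ) (φ : 𝓢(X, ℂ)) (y : X) (a : ℂ) :
    ∑ n ∈ Finset.range (K + 1), a ^ n *
      ∑ j ∈ Finset.range n, (emCoeff (j + 1) : ℂ) * emSum A (n - (j + 1)) ((dirDeriv v ^ j) φ) y =
    ∑ j ∈ Finset.range K, (emCoeff (j + 1) : ℂ) * a ^ (j + 1) *
      ∑ k ∈ Finset.range (K - j), a ^ k * emSum A k ((dirDeriv v ^ j) φ) y := by
  rw [Finset.sum_range_succ']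
  simp only [Finset.range_zero, Finset.sum_empty, mul_zero, add_zero]
  have h := Finset.sum_range_diag_flip K fun j k =>
    (emCoeff (j + 1) : ℂ) * a ^ (j + 1) * (a ^ k * emSum A k ((dirDeriv v ^ j) φ) y)
  simp only [Finset.mul_sum]
  rw [← h]
  refine Finset.sum_congr rfl fun n _ => Finset.sum_congr rfl fun j hj => ?_
  have hjn : j ≤ n := Nat.lt_succ_iff.1 (Finset.mem_range.1 hj)
  rw [Nat.add_sub_add_right]
  have : a ^ (n + 1) = a ^ (j + 1) * a ^ (n - j) := by
    rw [← pow_add]; congr 1; lia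
  rw [this]
  ring

/-- Euler–Maclaurin expansion on a simplicial cone, uniformly in the apex `y`. -/
theorem eulerMaclaurin_cone {C : Set X} (hC : IsSalient C) {A : Finset X}
    (hA : ∀ a ∈ A, a ∈ C ∧ a ≠ 0) (φ : 𝓢(X, ℂ)) (K m : ℕ) (hK : 0 < K) :
    ∃ D : ℝ, 0 ≤ D ∧ ∀ N : ℕ, 0 < N → ∀ y ∈ C,
      ‖∫ x, φ (y + x) ∂coneMeasure (sampling N) A -
        ∑ n ∈ Finset.range K, ((N : ℂ)⁻¹) ^ n * emSum A n φ y‖ ≤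
      D * ((N : ℝ) ^ K)⁻¹ * wt m y := by
  classical
  -- The hypothesis is needed for derivatives of `φ`, for lower orders, and for stronger decay in
  -- the apex.
  induction A using Finset.induction_on generalizing φ K m with
  | empty =>
    refine ⟨0, le_rfl, fun N hN y hy => ?_⟩
    rw [coneMeasure_empty, integral_dirac, Finset.sum_eq_single_of_mem 0 (by simpa using hK)]
    · simp [emSum_empty]
    · intro n _ hn
      simp [emSum_empty, hn]
  | insert v A hv ih =>
    have hA' : ∀ a ∈ A, a ∈ C ∧ a ≠ 0 := fun a ha => hA a (Finset.mem_insert_of_mem ha)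
    obtain ⟨hvC, hv0⟩ := hA v (Finset.mem_insert_self v A)
    obtain ⟨K, rfl⟩ : ∃ k, K = k + 1 := Nat.exists_eq_succ_of_ne_zero hK.ne'
    obtain ⟨β, hβ, hβ'⟩ := exists_halfLineBound
    obtain ⟨p, B, hcb⟩ := exists_coneBound_coneMeasure hC β A hA'
    -- The exponents `q1` and `q2` are the decay that must be demanded of the two errors so that
    -- integration over the remaining directions leaves decay of order `m`.
    obtain ⟨q1, B1, hB1, h1⟩ := hC.exists_norm_integral_translate_le p m B
    obtain ⟨D1, hD1, hR⟩ := eulerMaclaurin_line hC hvC hv0 φ K q1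
    obtain ⟨q2, B2, hB2, h2⟩ := hC.exists_norm_integral_line_le hvC hv0 m hβ
    obtain ⟨D2, hD2, hI⟩ := ih hA' φ (K + 1) q2 (Nat.succ_pos K)
    -- The guard `j < K` keeps the order `K - j` positive, as the induction hypothesis requires;
    -- other values of `j` are not used.
    have ih' : ∀ j : ℕ, ∃ D : ℝ, 0 ≤ D ∧ (j < K → ∀ N : ℕ, 0 < N → ∀ y ∈ C,
        ‖∫ x, (dirDeriv v ^ j) φ (y + x) ∂coneMeasure (sampling N) A -
        ∑ n ∈ Finset.range (K - j), ((N : ℂ)⁻¹) ^ n * emSum A n ((dirDeriv v ^ j) φ) y‖ ≤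
        D * ((N : ℝ) ^ (K - j))⁻¹ * wt m y) := by
      intro j
      by_cases hj : j < K
      · obtain ⟨D, hD, h⟩ := ih hA' ((dirDeriv v ^ j) φ) (K - j) m (Nat.sub_pos_of_lt hj)
        exact ⟨D, hD, fun _ => h⟩
      · exact ⟨0, le_rfl, fun h => absurd h hj⟩
    choose D3 hD3 hT using ih'
    refine ⟨B1 * D1 + B2 * D2 + ∑ j ∈ Finset.range K, |emCoeff (j + 1)| * D3 j,
      by have := Finset.sum_nonneg fun j (_ : j ∈ Finset.range K) =>
            mul_nonneg (abs_nonneg (emCoeff (j + 1))) (hD3 j)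
         positivity, fun N hN y hy => ?_⟩
    have := sigmaFinite_sampling hN
    set σ := coneMeasure (sampling N) A with hσ
    have hσb : ConeBound C σ p B := hcb _ (hβ' N hN)
    set c : ℂ := (N : ℂ)⁻¹ with hc
    -- the three parts of the expansion in the direction `v`
    set S : X → ℂ := fun z => ∫ t, φ (z + t • v) ∂sampling N with hS
    set J : X → ℂ := fun z => ∫ t, φ (z + t • v) ∂halfLine with hJ
    set T : X → ℂ := fun z => ∑ j ∈ Finset.range K,
          (emCoeff (j + 1) : ℂ) * ((N : ℂ) ^ (j + 1))⁻¹ * (dirDeriv v ^ j) φ z with hTdef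
    have hSint : Integrable (fun x => S (y + x)) σ := by
      have h := (integrable_prod_translate hC hvC hv0 (hβ' N hN) hσb φ hy).integral_prod_right
      refine h.congr (ae_of_all _ fun x => ?_)
      simp only [hS, add_right_comm]
    have hJint : Integrable (fun x => J (y + x)) σ := by
      have h := (integrable_prod_translate hC hvC hv0 hβ hσb φ hy).integral_prod_right
      refine h.congr (ae_of_all _ fun x => ?_)
      simp only [hJ, add_right_comm]
    have hTj : ∀ j ∈ Finset.range K, Integrable (fun x => (emCoeff (j + 1) : ℂ) *
        ((N : ℂ) ^ (j + 1))⁻¹ * (dirDeriv v ^ j) φ (y + x)) σ := fun j _ =>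
      (hσb.integrable_translate hC _ hy).const_mul _
    have hTint : Integrable (fun x => T (y + x)) σ := integrable_finsetSum _ hTj
    have e0 : ∫ x, φ (y + x) ∂coneMeasure (sampling N) (insert v A) = ∫ x, S (y + x) ∂σ := by
      have h := integral_coneMeasure_insert hC hA' hvC hv0 hv (sampling N) (hβ' N hN) φ hy
      rw [integral_integral_translate hC hvC hv0 (hβ' N hN) hσb φ hy] at h
      convert h
    have eJ : ∫ x, J (y + x) ∂σ = ∫ t, ∫ x, φ (y + t • v + x) ∂σ ∂halfLine :=
      (integral_integral_translate hC hvC hv0 hβ hσb φ hy).symm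
    have eT : ∫ x, T (y + x) ∂σ = ∑ j ∈ Finset.range K, (emCoeff (j + 1) : ℂ) * c ^ (j + 1) *
        ∫ x, (dirDeriv v ^ j) φ (y + x) ∂σ := by
      simp only [hTdef]
      rw [integral_finsetSum _ hTj]
      refine Finset.sum_congr rfl fun j _ => ?_
      rw [integral_const_mul, hc, inv_pow]
    have bR : ‖(∫ x, S (y + x) ∂σ) - (∫ x, J (y + x) ∂σ) - ∫ x, T (y + x) ∂σ‖ ≤
        B1 * (D1 * ((N : ℝ) ^ (K + 1))⁻¹) * wt m y := by
      have hSJ : Integrable (fun x => S (y + x) - J (y + x)) σ := hSint.sub hJint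
      rw [← integral_sub hSint hJint, ← integral_sub hSJ hTint]
      exact (h1 σ hσb (fun z => S z - J z - T z) _ (by positivity) (hR N hN) y hy).1
    -- the integral term
    have hJi : Integrable (fun t : ℝ => ∫ x, φ (y + t • v + x) ∂σ) halfLine :=
      (integrable_prod_translate hC hvC hv0 hβ hσb φ hy).integral_prod_left
    have hEi : ∀ n ∈ Finset.range (K + 1),
        Integrable (fun t : ℝ => c ^ n * emSum A n φ (y + t • v)) halfLine := fun n _ =>
      (integrable_emSum hC hA' hvC hv0 n φ hy).const_mul _
    have bJ : ‖(∫ t, ∫ x, φ (y + t • v + x) ∂σ ∂halfLine) -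
        ∑ n ∈ Finset.range (K + 1), c ^ n * ∫ t, emSum A n φ (y + t • v) ∂halfLine‖ ≤
        B2 * (D2 * ((N : ℝ) ^ (K + 1))⁻¹) * wt m y := by
      have e1 : ∑ n ∈ Finset.range (K + 1), c ^ n * ∫ t, emSum A n φ (y + t • v) ∂halfLine =
          ∫ t, ∑ n ∈ Finset.range (K + 1), c ^ n * emSum A n φ (y + t • v) ∂halfLine := by
        rw [integral_finsetSum _ hEi]
        exact Finset.sum_congr rfl fun n _ => (integral_const_mul _ _).symm
      rw [e1, ← integral_sub hJi (integrable_finsetSum _ hEi)]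
      exact h2 (fun z => ∫ x, φ (z + x) ∂σ - ∑ n ∈ Finset.range (K + 1), c ^ n * emSum A n φ z)
        _ (by positivity) (hI N hN) y hy
    -- the derivative terms
    have bT : ‖∑ j ∈ Finset.range K, (emCoeff (j + 1) : ℂ) * c ^ (j + 1) *
          ∫ x, (dirDeriv v ^ j) φ (y + x) ∂σ -
        ∑ j ∈ Finset.range K, (emCoeff (j + 1) : ℂ) * c ^ (j + 1) *
          ∑ k ∈ Finset.range (K - j), c ^ k * emSum A k ((dirDeriv v ^ j) φ) y‖ ≤
        (∑ j ∈ Finset.range K, |emCoeff (j + 1)| * D3 j) * ((N : ℝ) ^ (K + 1))⁻¹ * wt m y := by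
      rw [← Finset.sum_sub_distrib, mul_assoc, Finset.sum_mul]
      refine norm_sum_le_of_le _ fun j hj => ?_
      have hjK := Finset.mem_range.1 hj
      rw [← mul_sub, norm_mul, norm_mul, Complex.norm_real, Real.norm_eq_abs, norm_pow, hc,
        norm_inv, Complex.norm_natCast]
      refine (mul_le_mul_of_nonneg_left (hT j hjK N hN y hy) (by positivity)).trans (le_of_eq ?_)
      have : ((N : ℝ) ^ (K + 1))⁻¹ = ((N : ℝ)⁻¹) ^ (j + 1) * ((N : ℝ) ^ (K - j))⁻¹ := by
        rw [← inv_pow, ← inv_pow, ← pow_add]; congr 1; lia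
      rw [this]
      ring
    have eE : ∑ n ∈ Finset.range (K + 1), c ^ n * emSum (insert v A) n φ y =
        ∑ n ∈ Finset.range (K + 1), c ^ n * (∫ t, emSum A n φ (y + t • v) ∂halfLine) +
        ∑ j ∈ Finset.range K, (emCoeff (j + 1) : ℂ) * c ^ (j + 1) *
          ∑ k ∈ Finset.range (K - j), c ^ k * emSum A k ((dirDeriv v ^ j) φ) y := by
      rw [← sum_emSum_reindex, ← Finset.sum_add_distrib]
      refine Finset.sum_congr rfl fun n _ => ?_
      have h := emSum_insert hC hA' hvC hv0 hv n φ hy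
      rw [← mul_add, ← h]
    rw [e0, eE]
    rw [eJ, eT] at bR
    -- The three errors come from the expansion along `v`, from the smaller cone under the
    -- `v`-integral, and from the smaller cone applied to the derivatives of `φ`.
    have hsplit : ∀ s i t i' t' : ℂ, s - (i' + t') = (s - i - t) + (i - i') + (t - t') := by
      intros; ring
    rw [hsplit _ (∫ t, ∫ x, φ (y + t • v + x) ∂σ ∂halfLine)
      (∑ j ∈ Finset.range K, (emCoeff (j + 1) : ℂ) * c ^ (j + 1) *
          ∫ x, (dirDeriv v ^ j) φ (y + x) ∂σ)]
    refine (norm_add₃_le).trans ((add_le_add (add_le_add bR bJ) bT).trans (le_of_eq ?_))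
    ring

end

section

/-! ### Integration by parts on the faces of a cone -/

section Algebra

variable {X : Type*} [NormedAddCommGroup X] [InnerProductSpace ℝ X]

theorem dirDeriv_add (u v : X) : dirDeriv (u + v) = dirDeriv u + dirDeriv v := by
  ext φ x
  simp [dirDeriv, LineDeriv.lineDerivOp_left_add]

theorem dirDeriv_smul (a : ℝ) (v : X) : dirDeriv (a • v) = a • dirDeriv v := by
  ext φ x
  simp [dirDeriv, LineDeriv.lineDerivOp_left_smul]

/-- `dirDeriv` as a linear map. -/
def dirDerivₗ : X →ₗ[ℝ] Op X where
  toFun := dirDeriv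
  map_add' := dirDeriv_add
  map_smul' := dirDeriv_smul

theorem dirDeriv_sum {ι : Type*} (s : Finset ι) (f : ι → X) :
    dirDeriv (∑ i ∈ s, f i) = ∑ i ∈ s, dirDeriv (f i) :=
  map_sum dirDerivₗ f s

theorem commute_dirDeriv_prod (u : X) (l : List X) :
    Commute (dirDeriv u) (l.map dirDeriv).prod := by
  refine Commute.list_prod_right _ _ fun T hT => ?_
  obtain ⟨v, -, rfl⟩ := List.mem_map.1 hT
  exact dirDeriv_comm u v

variable [FiniteDimensional ℝ X]

open Classical in
theorem dirDeriv_eq_perpPart_add (E I : Finset X) (e : X) :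
    dirDeriv e = dirDeriv (perpPart E I e) + ∑ v ∈ E \ I, projCoeff E I e v • dirDeriv v := by
  have h1 : ∑ w ∈ E \ I, projCoeff E I e w • w = (spanCompl E I).starProjection e :=
    (exists_projCoeff E I e).choose_spec.2
  simp only [← dirDeriv_smul]
  rw [← dirDeriv_sum, h1, ← dirDeriv_add, perpPart, sub_add_cancel]

-- The recursion never removes elements from `I`.
open Classical in
theorem ibpList_eq_zero (E : Finset X) (l : List X) {I J : Finset X} (h : ¬I ⊆ J) :
    ibpList E l I J = 0 := by
  induction l generalizing I with
  | nil => rw [ibpList, if_neg fun h' => h h'.subset]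
  | cons e l ih =>
    rw [ibpList, ih h, zero_mul, zero_add]
    refine Finset.sum_eq_zero fun v _ => ?_
    rw [ih fun h' => h ((Finset.subset_insert v I).trans h'), smul_zero]

-- Each step of the recursion adds at most one element to `I`, so a short list cannot reach `J`.
open Classical in
theorem ibpList_eq_zero_of_card_lt (E : Finset X) (l : List X) {I J : Finset X}
    (h : I.card + l.length < J.card) : ibpList E l I J = 0 := by
  induction l generalizing I with
  | nil =>
    rw [ibpList, if_neg]
    rintro rfl
    simp at h
  | cons e l ih =>
    rw [List.length_cons] at h
    rw [ibpList, ih (by lia), zero_mul, zero_add]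
    refine Finset.sum_eq_zero fun v _ => ?_
    have := Finset.card_insert_le v I
    rw [ih (by lia), smul_zero]

open Classical in
/-- Integration by parts, for functionals `F I` which behave like the integrals over the faces
generated by `E \ I`. -/
theorem apply_prod_dirDeriv_eq (E : Finset X) (F : Finset X → 𝓢(X, ℂ) →ₗ[ℝ] ℂ)
    (hF : ∀ I ⊆ E, ∀ v ∈ E \ I, ∀ ψ, F I (dirDeriv v ψ) = -F (insert v I) ψ)
    (l : List X) {I : Finset X} (hI : I ⊆ E) (φ : 𝓢(X, ℂ)) :
    F I ((l.map dirDeriv).prod φ) =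
      ∑ J ∈ E.powerset, ((-1 : ℝ) ^ (J.card + I.card)) • F J (ibpList E l I J φ) := by
  induction l generalizing I φ with
  | nil =>
    rw [Finset.sum_eq_single_of_mem I (Finset.mem_powerset.2 hI)]
    · simp [ibpList, ← two_mul]
    · intro J _ hJ
      simp [ibpList, hJ.symm]
  | cons e l ih =>
    -- The orthogonal derivative is commuted to the right, where it changes the test function. The
    -- derivatives along the face stay outermost, where `hF` turns them into boundary terms.
    have h1 : ((e :: l).map dirDeriv).prod φ =
        (l.map dirDeriv).prod (dirDeriv (perpPart E I e) φ) +
          ∑ v ∈ E \ I, projCoeff E I e v • dirDeriv v ((l.map dirDeriv).prod φ) := by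
      have h2 : ((e :: l).map dirDeriv).prod =
          (l.map dirDeriv).prod * dirDeriv (perpPart E I e) +
          ∑ v ∈ E \ I, projCoeff E I e v • (dirDeriv v * (l.map dirDeriv).prod) := by
        rw [List.map_cons, List.prod_cons, dirDeriv_eq_perpPart_add E I e, add_mul,
          (commute_dirDeriv_prod _ l).eq, Finset.sum_mul]
        simp only [smul_mul_assoc]
      rw [h2]
      simp
    have h3 : ∀ v ∈ E \ I, F I (projCoeff E I e v • dirDeriv v ((l.map dirDeriv).prod φ)) =
        ∑ J ∈ E.powerset, ((-1 : ℝ) ^ (J.card + I.card)) •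
          F J (projCoeff E I e v • ibpList E l (insert v I) J φ) := by
      intro v hv
      have hv' := Finset.mem_sdiff.1 hv
      rw [map_smul, hF I hI v hv, ih (Finset.insert_subset hv'.1 hI), smul_neg, Finset.smul_sum,
        ← Finset.sum_neg_distrib]
      refine Finset.sum_congr rfl fun J _ => ?_
      rw [Finset.card_insert_of_notMem hv'.2, map_smul, ← add_assoc, pow_succ, smul_comm]
      simp
    rw [h1, map_add, map_sum, ih hI, Finset.sum_congr rfl h3, Finset.sum_comm,
      ← Finset.sum_add_distrib]
    refine Finset.sum_congr rfl fun J hJ => ?_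
    rw [← Finset.smul_sum, ← smul_add, ← map_sum, ← map_add]
    congr 2
    -- Integration by parts sums over all `v ∈ E \ I`, the recursion only over `J \ I`; the
    -- additional terms vanish because `insert v I` is not contained in `J`.
    have h4 : ∑ v ∈ E \ I, projCoeff E I e v • ibpList E l (insert v I) J φ =
        ∑ v ∈ J \ I, projCoeff E I e v • ibpList E l (insert v I) J φ := by
      symm
      refine Finset.sum_subset (Finset.sdiff_subset_sdiff (Finset.mem_powerset.1 hJ) le_rfl)
        fun v hv hvJ => ?_
      have : v ∉ J := fun h => hvJ (Finset.mem_sdiff.2 ⟨h, (Finset.mem_sdiff.1 hv).2⟩)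
      rw [ibpList_eq_zero E l fun h => this (h (Finset.mem_insert_self v I))]
      simp
    rw [h4, ibpList]
    simp

end Algebra

variable {X : Type*} [NormedAddCommGroup X] [InnerProductSpace ℝ X] [FiniteDimensional ℝ X]
  [MeasurableSpace X] [BorelSpace X]

theorem integral_halfLine_dirDeriv {C : Set X} (hC : IsSalient C) {v : X} (hv : v ∈ C)
    (hv0 : v ≠ 0) (φ : 𝓢(X, ℂ)) {z : X} (hz : z ∈ C) :
    ∫ t, dirDeriv v φ (z + t • v) ∂halfLine = -φ z := by
  obtain ⟨b, hb, -⟩ := exists_halfLineBound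
  obtain ⟨D, hD0, hD⟩ := hC.exists_line_bound hv hv0 φ 0
  obtain ⟨D', hD0', hD'⟩ := hC.exists_line_bound hv hv0 (dirDeriv v φ) 0
  have hcont : ∀ ψ : 𝓢(X, ℂ), Continuous fun t : ℝ => ψ (z + t • v) := fun ψ =>
    ψ.continuous.comp (by fun_prop)
  have hint : IntegrableOn (fun t : ℝ => dirDeriv v φ (z + t • v)) (Set.Ioi 0) :=
    hb.integrable_of_bound (hcont _).aestronglyMeasurable (hD' z hz)
  have htend : Tendsto (fun t : ℝ => φ (z + t • v)) atTop (𝓝 0) := by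
    have h3 : Tendsto (fun t : ℝ => (1 + |t|) ^ 2) atTop atTop :=
      (tendsto_pow_atTop (by norm_num)).comp
        (tendsto_atTop_add_const_left _ _ tendsto_abs_atTop_atTop)
    have h2 : Tendsto (fun t : ℝ => D * wt 0 z * ((1 + |t|) ^ 2)⁻¹) atTop (𝓝 0) := by
      simpa using h3.inv_tendsto_atTop.const_mul (D * wt 0 z)
    exact squeeze_zero_norm' ((eventually_ge_atTop 0).mono fun t ht => hD z hz t ht) h2
  have h := integral_Ioi_of_hasDerivAt_of_tendsto (hcont φ).continuousWithinAt
    (fun t _ => hasDerivAt_line φ z v t) hint htend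
  rw [halfLine, h]
  simp

theorem integrable_coneMeasure_halfLine {C : Set X} (hC : IsSalient C) {A : Finset X}
    (hA : ∀ a ∈ A, a ∈ C ∧ a ≠ 0) (φ : 𝓢(X, ℂ)) :
    Integrable (fun x => φ x) (coneMeasure halfLine A) := by
  obtain ⟨b, hb, -⟩ := exists_halfLineBound
  obtain ⟨p, B, h⟩ := exists_coneBound_coneMeasure hC b A hA
  simpa using (h _ hb).integrable_translate hC φ hC.zero_mem

-- After Fubini the inner integral along `v` is the fundamental theorem of calculus; only the value
-- on the facet survives. This is the hypothesis `hF` of `apply_prod_dirDeriv_eq`.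
open Classical in
theorem integral_dirDeriv_coneMeasure_insert {C : Set X} (hC : IsSalient C) {A : Finset X}
    (hA : ∀ a ∈ A, a ∈ C ∧ a ≠ 0) {v : X} (hv : v ∈ C) (hv0 : v ≠ 0) (hvA : v ∉ A)
    (φ : 𝓢(X, ℂ)) :
    ∫ x, dirDeriv v φ x ∂coneMeasure halfLine (insert v A) =
      -∫ x, φ x ∂coneMeasure halfLine A := by
  obtain ⟨b, hb, -⟩ := exists_halfLineBound
  obtain ⟨p, B, h⟩ := exists_coneBound_coneMeasure hC b A hA
  have h1 := integral_coneMeasure_insert hC hA hv hv0 hvA halfLine hb (dirDeriv v φ) hC.zero_mem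
  rw [integral_integral_translate hC hv hv0 hb (h _ hb) _ hC.zero_mem] at h1
  simp only [zero_add] at h1
  rw [h1, ← integral_neg]
  exact integral_congr_ae ((h _ hb).mem.mono fun x hx => integral_halfLine_dirDeriv hC hv hv0 φ hx)

open Classical in
theorem integral_prod_dirDeriv_coneMeasure {C : Set X} (hC : IsSalient C) {E : Finset X}
    (hE : ∀ a ∈ E, a ∈ C ∧ a ≠ 0) (l : List X) {I : Finset X} (hI : I ⊆ E) (φ : 𝓢(X, ℂ)) :
    ∫ x, (l.map dirDeriv).prod φ x ∂coneMeasure halfLine (E \ I) =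
      ∑ J ∈ E.powerset, ((-1 : ℝ) ^ (J.card + I.card)) •
        ∫ x, ibpList E l I J φ x ∂coneMeasure halfLine (E \ J) := by
  have hE' : ∀ I : Finset X, ∀ a ∈ E \ I, a ∈ C ∧ a ≠ 0 := fun I a ha =>
    hE a (Finset.mem_sdiff.1 ha).1
  let F : Finset X → 𝓢(X, ℂ) →ₗ[ℝ] ℂ := fun I =>
    { toFun := fun ψ => ∫ x, ψ x ∂coneMeasure halfLine (E \ I)
      map_add' := fun ψ χ => integral_add (integrable_coneMeasure_halfLine hC (hE' I) ψ)
        (integrable_coneMeasure_halfLine hC (hE' I) χ)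
      map_smul' := fun a _ => integral_smul a _ }
  refine apply_prod_dirDeriv_eq E F (fun I hI v hv ψ => ?_) l hI φ
  have hv' := Finset.mem_sdiff.1 hv
  have hset : E \ I = insert v (E \ insert v I) := by
    ext w
    simp only [Finset.mem_sdiff, Finset.mem_insert]
    by_cases h : w = v
    · subst h; simp [hv'.1, hv'.2]
    · simp [h]
  change ∫ x, dirDeriv v ψ x ∂coneMeasure halfLine (E \ I) =
    -∫ x, ψ x ∂coneMeasure halfLine (E \ insert v I)
  rw [hset]
  exact integral_dirDeriv_coneMeasure_insert hC (hE' _) (hE v hv'.1).1 (hE v hv'.1).2 (by simp) ψ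

end

section

variable {X : Type*} [NormedAddCommGroup X] [InnerProductSpace ℝ X] [FiniteDimensional ℝ X]

/-! ### The expansion coefficients in terms of the operators `𝒟_n` -/

open Classical in
/-- The operator `𝒟_n(C; F)` with the face `F` described by `J = I_F`. -/
def indexOp (n : ℕ) (E J : Finset X) : Op X :=
  (-1 : ℝ) ^ (n - J.card) •
    ∑ I ∈ J.powerset,
      ∑ ν ∈ (I.finsuppAntidiag n).filter (fun ν : X →₀ ℕ => ν.support = I),
        ((∏ e ∈ I, toddP (ν e) : ℚ) : ℝ) • ibpOp E I J (Finsupp.toMultiset ν - I.val)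

theorem coneOp_eq_indexOp (n : ℕ) (E : Finset X) (F : Set X) :
    coneOp n E F = indexOp n E (faceIndex E F) := rfl

open Classical in
theorem card_toMultiset_sub {n : ℕ} {I : Finset X} {ν : X →₀ ℕ}
    (hν : ν ∈ (I.finsuppAntidiag n).filter (fun ν : X →₀ ℕ => ν.support = I)) :
    I.card + Multiset.card (Finsupp.toMultiset ν - I.val) = n := by
  obtain ⟨h1, h2⟩ := Finset.mem_filter.1 hν
  have hle : I.val ≤ Finsupp.toMultiset ν := by
    rw [Multiset.le_iff_subset I.nodup]
    intro e he
    rw [Finsupp.mem_toMultiset, h2]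
    exact he
  have h3 := Multiset.card_le_card hle
  have h4 : Multiset.card (Finsupp.toMultiset ν) = n := by
    rw [Finsupp.card_toMultiset, ← (Finset.mem_finsuppAntidiag.1 h1).1, Finsupp.sum, h2]
    rfl
  rw [Multiset.card_sub hle]
  change Multiset.card I.val + _ = n
  lia

-- Each factor carries the sign `(-1)^{ν(e) - 1}`. The factor `(-1)^{|I|}`, which integration by
-- parts supplies, completes the product of signs to `(-1)^n`.
open Classical in
theorem prod_emCoeff_mul {n : ℕ} {I : Finset X} {ν : X →₀ ℕ}
    (hν : ν ∈ (I.finsuppAntidiag n).filter (fun ν : X →₀ ℕ => ν.support = I)) :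
    (∏ e ∈ I, emCoeff (ν e)) * (-1) ^ I.card = (-1) ^ n * ((∏ e ∈ I, toddP (ν e) : ℚ) : ℝ) := by
  obtain ⟨h1, h2⟩ := Finset.mem_filter.1 hν
  rw [← (Finset.mem_finsuppAntidiag.1 h1).1, ← Finset.prod_pow_eq_pow_sum, ← Finset.prod_const,
    ← Finset.prod_mul_distrib]
  push_cast
  rw [← Finset.prod_mul_distrib]
  refine Finset.prod_congr rfl fun e he => ?_
  have hne : ν e ≠ 0 := by
    rw [← h2] at he
    exact Finsupp.mem_support_iff.1 he
  rw [emCoeff_eq hne]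
  obtain ⟨k, hk⟩ := Nat.exists_eq_succ_of_ne_zero hne
  rw [hk, Nat.succ_eq_add_one, Nat.add_sub_cancel, pow_succ]
  ring

variable [MeasurableSpace X] [BorelSpace X]

/-- Integration over the face generated by `A`. -/
def faceFunctional {C : Set X} (hC : IsSalient C) {A : Finset X}
    (hA : ∀ a ∈ A, a ∈ C ∧ a ≠ 0) : 𝓢(X, ℂ) →ₗ[ℝ] ℂ where
  toFun := fun ψ => ∫ x, ψ x ∂coneMeasure halfLine A
  map_add' := fun ψ χ => integral_add (integrable_coneMeasure_halfLine hC hA ψ)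
    (integrable_coneMeasure_halfLine hC hA χ)
  map_smul' := fun a _ => integral_smul a _

-- Multi-indices are grouped by support `I`, each term is integrated by parts down to the faces `E \
-- J`, and the sums over `I` and `J` are exchanged. Faces with `|J| > n` receive nothing, because
-- only `n - |I|` derivatives are available.
open Classical in
theorem emSum_eq_sum_indexOp {C : Set X} (hC : IsSalient C) {E : Finset X}
    (hE : ∀ a ∈ E, a ∈ C ∧ a ≠ 0) (n : ℕ) (φ : 𝓢(X, ℂ)) :
    emSum E n φ 0 = ∑ J ∈ E.powerset.filter (fun J => J.card ≤ n),
      ∫ x, indexOp n E J φ x ∂coneMeasure halfLine (E \ J) := by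
  have hE' : ∀ I : Finset X, ∀ a ∈ E \ I, a ∈ C ∧ a ≠ 0 := fun I a ha =>
    hE a (Finset.mem_sdiff.1 ha).1
  let F : Finset X → 𝓢(X, ℂ) →ₗ[ℝ] ℂ := fun I => faceFunctional hC (hE' I)
  let G : Finset X → Finset (X →₀ ℕ) := fun I =>
    (I.finsuppAntidiag n).filter (fun ν : X →₀ ℕ => ν.support = I)
  -- a single multi-index
  have hterm : ∀ I ∈ E.powerset, ∀ ν ∈ G I, emTerm E ν φ 0 =
      ∑ J ∈ E.powerset.filter (fun J => J.card ≤ n), ((-1 : ℝ) ^ (n - J.card)) •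
        ((∏ e ∈ I, toddP (ν e) : ℚ) : ℝ) •
          F J (ibpOp E I J (Finsupp.toMultiset ν - I.val) φ) := by
    intro I hI ν hν
    have hs : ν.support = I := (Finset.mem_filter.1 hν).2
    have h1 := integral_prod_dirDeriv_coneMeasure hC hE
      (Finsupp.toMultiset ν - I.val).toList (Finset.mem_powerset.1 hI) φ
    rw [emTerm, hs]
    simp only [zero_add]
    rw [iterDeriv, h1, Finset.sum_filter, Finset.mul_sum]
    refine Finset.sum_congr rfl fun J _ => ?_
    split_ifs with hJ
    · change _ * (_ • F J _) = _
      rw [← Complex.real_smul, smul_smul, smul_smul]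
      congr 1
      rw [add_comm J.card, pow_add, ← mul_assoc, prod_emCoeff_mul hν]
      have h2 : (-1 : ℝ) ^ n = (-1) ^ (n - J.card) * (-1) ^ J.card := by
        rw [← pow_add]; congr 1; lia
      have h3 : (-1 : ℝ) ^ J.card * (-1) ^ J.card = 1 := by rw [← mul_pow]; simp
      rw [h2]
      linear_combination ((-1 : ℝ) ^ (n - J.card) * ((∏ e ∈ I, toddP (ν e) : ℚ) : ℝ)) * h3
    · have hc := card_toMultiset_sub hν
      rw [ibpList_eq_zero_of_card_lt E _ (by rw [Multiset.length_toList]; lia)]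
      simp
  have hsupp : ∀ I ∈ E.powerset,
      (E.finsuppAntidiag n).filter (fun ν : X →₀ ℕ => ν.support = I) = G I := by
    intro I hI
    ext ν
    simp only [G, Finset.mem_filter, Finset.mem_finsuppAntidiag']
    constructor
    · rintro ⟨⟨h1, -⟩, h3⟩
      exact ⟨⟨h1, h3.subset⟩, h3⟩
    · rintro ⟨⟨h1, -⟩, h3⟩
      exact ⟨⟨h1, h3.subset.trans (Finset.mem_powerset.1 hI)⟩, h3⟩
  have hL : emSum E n φ 0 = ∑ I ∈ E.powerset, ∑ ν ∈ G I, emTerm E ν φ 0 := by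
    rw [emSum, ← Finset.sum_fiberwise_of_maps_to (g := fun ν : X →₀ ℕ => ν.support)
      (t := E.powerset) fun ν hν => Finset.mem_powerset.2 (Finset.mem_finsuppAntidiag.1 hν).2]
    exact Finset.sum_congr rfl fun I hI => by rw [hsupp I hI]
  rw [hL, Finset.sum_congr rfl fun I hI => (Finset.sum_congr rfl (hterm I hI)).trans
    Finset.sum_comm, Finset.sum_comm]
  refine Finset.sum_congr rfl fun J hJ => ?_
  have hJE := Finset.mem_powerset.1 (Finset.mem_filter.1 hJ).1
  change _ = F J (indexOp n E J φ)
  have hR : indexOp n E J φ = (-1 : ℝ) ^ (n - J.card) • ∑ I ∈ J.powerset, ∑ ν ∈ G I,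
      ((∏ e ∈ I, toddP (ν e) : ℚ) : ℝ) • ibpOp E I J (Finsupp.toMultiset ν - I.val) φ := by
    simp [indexOp, G]
  rw [hR, map_smul, map_sum, Finset.smul_sum]
  symm
  -- Supports `I` not contained in `J` contribute zero, which reduces the sum to the subsets of `J`
  -- occurring in `𝒟_n`.
  refine Finset.sum_subset_zero_on_sdiff (Finset.powerset_mono.2 hJE) (fun I hI => ?_)
    fun I _ => ?_
  · have : ¬I ⊆ J := fun h => (Finset.mem_sdiff.1 hI).2 (Finset.mem_powerset.2 h)
    refine Finset.sum_eq_zero fun ν _ => ?_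
    rw [ibpOp, ibpList_eq_zero E _ this]
    simp
  · rw [map_sum, Finset.smul_sum]
    exact Finset.sum_congr rfl fun ν _ => by rw [map_smul]

end

section

variable {X : Type*} [NormedAddCommGroup X] [InnerProductSpace ℝ X] [FiniteDimensional ℝ X]

/-! ### Geometry of unimodular cones -/

/-- Linear forms dual to the family `E` which are integral on the lattice. -/
structure DualSystem (Λ : Submodule ℤ X) (E : Finset X) (c : X → X →L[ℝ] ℝ) : Prop where
  self : ∀ e ∈ E, c e e = 1
  ne : ∀ e ∈ E, ∀ f ∈ E, f ≠ e → c e f = 0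
  integral : ∀ e ∈ E, ∀ x ∈ Λ, ∃ k : ℤ, c e x = k
  mem : ∀ e ∈ E, e ∈ Λ

/-- A ℤ-basis of the full lattice is also a real basis, and its coordinate forms are integral on
`Λ`. Unimodularity enters only through these forms. -/
theorem exists_dualSystem (Λ : Submodule ℤ X) [DiscreteTopology Λ] [IsZLattice ℝ Λ] {E : Finset X}
    (hE : IsPartOfIntegralBasis Λ E) : ∃ c, DualSystem Λ E c := by
  classical
  obtain ⟨B, hEB, hli, hspan⟩ := hE
  have hr : Submodule.span ℤ (Set.range fun i : B => id (i : X)) = Λ := by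
    simpa using hspan
  let b : Module.Basis B ℤ Λ := (Module.Basis.span hli).map (LinearEquiv.ofEq _ _ hr)
  have hb : ∀ i : B, ((b i : Λ) : X) = i := fun i => by
    simp only [b, Module.Basis.map_apply, LinearEquiv.coe_ofEq_apply]
    exact congrArg Subtype.val (Module.Basis.span_apply hli i)
  let b' := b.ofZLatticeBasis ℝ Λ
  have hb' : ∀ i : B, b' i = i := fun i => by
    rw [← hb i]; exact b.ofZLatticeBasis_apply ℝ Λ i
  refine ⟨fun e => if h : e ∈ B then LinearMap.toContinuousLinearMap (b'.coord ⟨e, h⟩) else 0,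
    ⟨?_, ?_, ?_, ?_⟩⟩
  · intro e he
    have heB := hEB he
    have h1 : b'.repr (b' ⟨e, heB⟩) ⟨e, heB⟩ = 1 := by simp
    rw [hb'] at h1
    simpa [heB] using h1
  · intro e he f hf hfe
    have heB := hEB he
    have hfB := hEB hf
    have h1 : b'.repr (b' ⟨f, hfB⟩) ⟨e, heB⟩ = 0 := by
      simp [hfe]
    rw [hb'] at h1
    simpa [heB] using h1
  · intro e he x hx
    have heB := hEB he
    refine ⟨b.repr ⟨x, hx⟩ ⟨e, heB⟩, ?_⟩
    have h1 := b.ofZLatticeBasis_repr_apply ℝ Λ ⟨x, hx⟩ ⟨e, heB⟩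
    simpa [heB] using h1
  · intro e he
    have h1 := (b ⟨e, hEB he⟩).2
    rwa [hb] at h1

theorem coneGen_mono {S E : Finset X} (h : S ⊆ E) : coneGen S ⊆ coneGen E := by
  classical
  rintro x ⟨t, ht, rfl⟩
  refine ⟨fun e => if e ∈ S then t e else 0, fun e _ => ?_, ?_⟩
  · dsimp only
    split_ifs with h
    exacts [ht e h, le_rfl]
  · rw [← Finset.sum_subset h fun e _ he => by simp [he]]
    exact Finset.sum_congr rfl fun e he => by simp [he]

theorem mem_coneGen_of_mem {E : Finset X} {e : X} (he : e ∈ E) : e ∈ coneGen E := by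
  classical
  refine ⟨fun f => if f = e then 1 else 0, fun f _ => by dsimp only; split_ifs <;> norm_num, ?_⟩
  rw [Finset.sum_eq_single_of_mem e he fun f _ hf => by simp [hf]]
  simp

theorem zero_mem_coneGen (E : Finset X) : (0 : X) ∈ coneGen E :=
  ⟨0, fun _ _ => le_rfl, by simp⟩

theorem vectorSpan_coneGen (E : Finset X) :
    vectorSpan ℝ (coneGen E) = Submodule.span ℝ (E : Set X) := by
  rw [vectorSpan_eq_span_vsub_set_right ℝ (zero_mem_coneGen E)]
  refine le_antisymm (Submodule.span_le.2 ?_) (Submodule.span_mono ?_)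
  · rintro _ ⟨x, ⟨t, -, rfl⟩, rfl⟩
    simp only [vsub_eq_sub, sub_zero]
    exact Submodule.sum_mem _ fun e he => Submodule.smul_mem _ _ (Submodule.subset_span he)
  · intro e he
    exact ⟨e, mem_coneGen_of_mem he, by simp⟩

namespace DualSystem

variable {Λ : Submodule ℤ X} {E : Finset X} {c : X → X →L[ℝ] ℝ}

theorem mono (h : DualSystem Λ E c) {S : Finset X} (hS : S ⊆ E) : DualSystem Λ S c :=
  ⟨fun e he => h.self e (hS he), fun e he f hf => h.ne e (hS he) f (hS hf),
    fun e he => h.integral e (hS he), fun e he => h.mem e (hS he)⟩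

theorem apply_sum (h : DualSystem Λ E c) (t : X → ℝ) {e : X} (he : e ∈ E) :
    c e (∑ f ∈ E, t f • f) = t e := by
  rw [map_sum, Finset.sum_eq_single_of_mem e he fun f hf hfe => by
    rw [map_smul, h.ne e he f hf hfe, smul_zero]]
  rw [map_smul, h.self e he, smul_eq_mul, mul_one]

theorem eq_sum_of_mem_span (h : DualSystem Λ E c) {x : X}
    (hx : x ∈ Submodule.span ℝ (E : Set X)) : x = ∑ e ∈ E, c e x • e := by
  obtain ⟨t, -, rfl⟩ := Submodule.mem_span_finset.1 hx
  exact Finset.sum_congr rfl fun e he => by rw [h.apply_sum t he]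

theorem mem_coneGen_iff (h : DualSystem Λ E c) {x : X} :
    x ∈ coneGen E ↔ (∀ e ∈ E, 0 ≤ c e x) ∧ x = ∑ e ∈ E, c e x • e := by
  constructor
  · rintro ⟨t, ht, rfl⟩
    refine ⟨fun e he => by rw [h.apply_sum t he]; exact ht e he, ?_⟩
    exact Finset.sum_congr rfl fun e he => by rw [h.apply_sum t he]
  · rintro ⟨h1, h2⟩
    exact ⟨fun e => c e x, h1, h2⟩

theorem linearIndepOn (h : DualSystem Λ E c) : LinearIndepOn ℝ id (E : Set X) := by
  rw [linearIndepOn_finset_iff]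
  intro t ht e he
  have h1 := h.apply_sum t he
  simp only [id] at ht
  rw [ht, map_zero] at h1
  exact h1.symm

theorem sdim_coneGen (h : DualSystem Λ E c) : sdim (coneGen E) = E.card := by
  rw [sdim, vectorSpan_coneGen]
  exact finrank_span_finset_eq_card h.linearIndepOn

theorem ne_zero (h : DualSystem Λ E c) {e : X} (he : e ∈ E) : e ≠ 0 := by
  rintro rfl
  have := h.self 0 he
  simp at this

theorem mem_coneGen (h : DualSystem Λ E c) {e : X} (he : e ∈ E) : e ∈ coneGen E ∧ e ≠ 0 :=
  ⟨mem_coneGen_of_mem he, h.ne_zero he⟩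

theorem isSalient (h : DualSystem Λ E c) : IsSalient (coneGen E) where
  zero_mem := zero_mem_coneGen E
  add_mem := by
    rintro _ ⟨s, hs, rfl⟩ _ ⟨t, ht, rfl⟩
    refine ⟨s + t, fun e he => add_nonneg (hs e he) (ht e he), ?_⟩
    simp [add_smul, Finset.sum_add_distrib]
  smul_mem := by
    rintro a ha _ ⟨s, hs, rfl⟩
    refine ⟨fun e => a * s e, fun e he => mul_nonneg ha (hs e he), ?_⟩
    simp [mul_smul, Finset.smul_sum]
  isClosed := by
    have h1 : coneGen E = (⋂ e ∈ E, {x | 0 ≤ c e x}) ∩ {x | x = ∑ e ∈ E, c e x • e} := by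
      ext x
      simp [h.mem_coneGen_iff]
    rw [h1]
    refine IsClosed.inter (isClosed_biInter fun e _ => ?_) ?_
    · exact isClosed_le continuous_const (c e).continuous
    · exact isClosed_eq continuous_id (by fun_prop)
  exists_form := by
    -- The triangle inequality applied to `x = ∑ c_e(x) e`, whose coefficients are nonnegative on
    -- the cone.
    refine ⟨∑ e ∈ E, ‖e‖ • c e, fun x hx => ?_⟩
    obtain ⟨h1, h2⟩ := h.mem_coneGen_iff.1 hx
    calc ‖x‖ = ‖∑ e ∈ E, c e x • e‖ := by rw [← h2]
      _ ≤ ∑ e ∈ E, ‖e‖ * c e x := by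
        refine norm_sum_le_of_le _ fun e he => ?_
        rw [norm_smul, Real.norm_of_nonneg (h1 e he), mul_comm]
      _ = _ := by simp

open Classical in
theorem mem_coneGen_subset_iff (h : DualSystem Λ E c) {S : Finset X} (hS : S ⊆ E) {x : X} :
    x ∈ coneGen S ↔ x ∈ coneGen E ∧ ∀ e ∈ E \ S, c e x = 0 := by
  constructor
  · intro hx
    refine ⟨coneGen_mono hS hx, fun e he => ?_⟩
    obtain ⟨heE, heS⟩ := Finset.mem_sdiff.1 he
    obtain ⟨t, -, rfl⟩ := hx
    rw [map_sum]
    refine Finset.sum_eq_zero fun f hf => ?_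
    rw [map_smul, h.ne e heE f (hS hf) fun hfe => heS (hfe ▸ hf), smul_zero]
  · rintro ⟨hx, hx0⟩
    obtain ⟨h1, h2⟩ := h.mem_coneGen_iff.1 hx
    refine ⟨fun e => c e x, fun e he => h1 e (hS he), ?_⟩
    nth_rw 1 [h2]
    refine (Finset.sum_subset hS fun e he heS => ?_).symm
    rw [hx0 e (Finset.mem_sdiff.2 ⟨he, heS⟩), zero_smul]

open Classical in
theorem mem_coneGen_iff_mem (h : DualSystem Λ E c) {S : Finset X} (hS : S ⊆ E) {e : X}
    (he : e ∈ E) : e ∈ coneGen S ↔ e ∈ S := by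
  refine ⟨fun hx => ?_, mem_coneGen_of_mem⟩
  by_contra heS
  have := ((h.mem_coneGen_subset_iff hS).1 hx).2 e (Finset.mem_sdiff.2 ⟨he, heS⟩)
  rw [h.self e he] at this
  exact one_ne_zero this

open Classical in
theorem faceIndex_coneGen (h : DualSystem Λ E c) {J : Finset X} (hJ : J ⊆ E) :
    faceIndex E (coneGen (E \ J)) = J := by
  ext e
  rw [faceIndex, Finset.mem_filter]
  constructor
  · rintro ⟨he, h1⟩
    by_contra heJ
    exact h1 (mem_coneGen_of_mem (Finset.mem_sdiff.2 ⟨he, heJ⟩))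
  · intro he
    refine ⟨hJ he, fun h1 => ?_⟩
    exact (Finset.mem_sdiff.1
      ((h.mem_coneGen_iff_mem Finset.sdiff_subset (hJ he)).1 h1)).2 he

-- The exposing form is minus the sum of the coordinates in `J`: its maximum on the cone is zero,
-- attained where all these coordinates vanish.
open Classical in
theorem coneGen_mem_faces (h : DualSystem Λ E c) {J : Finset X} (hJ : J ⊆ E) :
    coneGen (E \ J) ∈ faces (coneGen E) := by
  refine ⟨⟨0, zero_mem_coneGen _⟩, fun _ => ⟨-∑ e ∈ J, c e, ?_⟩⟩
  have hval : ∀ x, (-∑ e ∈ J, c e : X →L[ℝ] ℝ) x = -∑ e ∈ J, c e x := fun x => by simp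
  have hnn : ∀ x ∈ coneGen E, 0 ≤ ∑ e ∈ J, c e x := fun x hx =>
    Finset.sum_nonneg fun e he => (h.mem_coneGen_iff.1 hx).1 e (hJ he)
  have hEJ : E \ (E \ J) = J := Finset.sdiff_sdiff_eq_self hJ
  ext x
  rw [h.mem_coneGen_subset_iff Finset.sdiff_subset, hEJ, Set.mem_ofPred_eq]
  refine and_congr_right fun hx => ⟨fun hx0 y hy => ?_, fun hmax e he => ?_⟩
  · rw [hval, hval, Finset.sum_eq_zero hx0]
    linarith [hnn y hy]
  · have h1 := hmax 0 (zero_mem_coneGen E)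
    rw [hval, hval] at h1
    simp only [map_zero, Finset.sum_const_zero, neg_zero] at h1
    have h2 : ∑ e ∈ J, c e x = 0 := le_antisymm (by linarith) (hnn x hx)
    exact (Finset.sum_eq_zero_iff_of_nonneg fun e he =>
      (h.mem_coneGen_iff.1 hx).1 e (hJ he)).1 h2 e he

-- A form attaining its maximum on a cone is nonpositive there, with maximum zero. Since `l x = ∑
-- c_e(x) l(e)` has only nonpositive terms, it vanishes exactly when `x` uses only generators killed
-- by `l`, that is, those lying on `F`.
open Classical in
theorem eq_coneGen_of_mem_faces (h : DualSystem Λ E c) {F : Set X} (hF : F ∈ faces (coneGen E)) :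
    F = coneGen (E \ faceIndex E F) := by
  obtain ⟨⟨x0, hx0⟩, hexp⟩ := hF
  obtain ⟨l, hl⟩ := hexp ⟨x0, hx0⟩
  have hS := h.isSalient
  rw [hl] at hx0
  have hneg : ∀ y ∈ coneGen E, l y ≤ 0 := fun y hy => by
    have := hx0.2 _ (hS.add_mem _ hx0.1 _ hy)
    rw [map_add] at this
    linarith
  have hmem : ∀ x, x ∈ F ↔ x ∈ coneGen E ∧ l x = 0 := by
    intro x
    rw [hl]
    refine and_congr_right fun hx => ⟨fun hmax => ?_, fun h0 y hy => ?_⟩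
    · have := hmax 0 (zero_mem_coneGen E)
      rw [map_zero] at this
      exact le_antisymm (hneg x hx) this
    · rw [h0]; exact hneg y hy
  ext x
  have hsub : E \ (E \ faceIndex E F) = faceIndex E F :=
    Finset.sdiff_sdiff_eq_self (Finset.filter_subset _ _)
  rw [h.mem_coneGen_subset_iff Finset.sdiff_subset, hmem, hsub]
  refine and_congr_right fun hx => ?_
  obtain ⟨h1, h2⟩ := h.mem_coneGen_iff.1 hx
  have hlx : l x = ∑ e ∈ E, c e x * l e := by
    nth_rw 1 [h2]
    simp
  have hterm : ∀ e ∈ E, c e x * l e ≤ 0 := fun e he =>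
    mul_nonpos_of_nonneg_of_nonpos (h1 e he) (hneg e (mem_coneGen_of_mem he))
  rw [hlx, Finset.sum_eq_zero_iff_of_nonpos hterm]
  constructor
  · intro h0 e he
    obtain ⟨heE, heF⟩ := Finset.mem_filter.1 he
    have : l e ≠ 0 := fun hle => heF ((hmem e).2 ⟨mem_coneGen_of_mem heE, hle⟩)
    exact (mul_eq_zero.1 (h0 e heE)).resolve_right this
  · intro h0 e he
    by_cases heF : e ∈ F
    · rw [((hmem e).1 heF).2, mul_zero]
    · rw [h0 e (Finset.mem_filter.2 ⟨he, heF⟩), zero_mul]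

open Classical in
theorem faces_eq_image (h : DualSystem Λ E c) :
    faces (coneGen E) = (fun J => coneGen (E \ J)) '' (E.powerset : Set (Finset X)) := by
  ext F
  constructor
  · intro hF
    exact ⟨faceIndex E F, Finset.mem_coe.2 (Finset.mem_powerset.2 (Finset.filter_subset _ _)),
      (h.eq_coneGen_of_mem_faces hF).symm⟩
  · rintro ⟨J, hJ, rfl⟩
    exact h.coneGen_mem_faces (Finset.mem_powerset.1 hJ)

theorem finite_faces (h : DualSystem Λ E c) : (faces (coneGen E)).Finite := by
  classical
  rw [h.faces_eq_image]
  exact (Finset.finite_toSet _).image _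

open Classical in
theorem sdim_face (h : DualSystem Λ E c) {J : Finset X} (hJ : J ⊆ E) :
    sdim (coneGen (E \ J)) + J.card = E.card := by
  rw [(h.mono Finset.sdiff_subset).sdim_coneGen, Finset.card_sdiff_add_card_eq_card hJ]

end DualSystem

end

section

variable {X : Type*} [NormedAddCommGroup X] [InnerProductSpace ℝ X] [FiniteDimensional ℝ X]
  [MeasurableSpace X] [BorelSpace X]

/-! ### The normalised Lebesgue measure on a face -/

theorem basis_addHaar_eq_map {ι V : Type*} [Fintype ι] [NormedAddCommGroup V] [NormedSpace ℝ V]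
    [MeasurableSpace V] [BorelSpace V] [FiniteDimensional ℝ V] (b : Module.Basis ι ℝ V) :
    b.addHaar = (volume : Measure (ι → ℝ)).map fun t => ∑ i, t i • b i := by
  classical
  have h1 : (Pi.basisFun ℝ ι).addHaar = volume := by
    rw [Module.Basis.addHaar_def, Module.Basis.parallelepiped_basisFun,
      addHaarMeasure_eq_volume_pi]
  have h2 := (Pi.basisFun ℝ ι).map_addHaar b.equivFunL.symm
  have h4 : (⇑b.equivFunL.symm : (ι → ℝ) → V) = fun t => ∑ i, t i • b i := by
    funext t
    exact b.equivFun_symm_apply t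
  have h3 : (Pi.basisFun ℝ ι).map b.equivFunL.symm.toLinearEquiv = b :=
    Module.Basis.eq_of_apply_eq fun i => by
      rw [Module.Basis.map_apply]
      refine (congrFun h4 _).trans ?_
      simp [Pi.single_apply]
  rw [h1, h3, h4] at h2
  exact h2.symm

namespace DualSystem

variable {Λ : Submodule ℤ X} {E S : Finset X} {c : X → X →L[ℝ] ℝ}

/-- Integrality of the dual forms shows that `S` generates `L ∩ Λ`, so the covolume is the volume of
the parallelepiped on `S`. Dividing by it leaves Lebesgue measure in the coordinates given by `S`,
independently of the Euclidean structure. -/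
theorem latticeMeasure_eq_map (h : DualSystem Λ S c) (L : Submodule ℝ X)
    (hL : L = Submodule.span ℝ (S : Set X)) :
    ∃ hmem : ∀ t : S → ℝ, ∑ e, t e • (e : X) ∈ L,
      latticeMeasure Λ L = (volume : Measure (S → ℝ)).map fun t => ⟨∑ e, t e • (e : X), hmem t⟩ := by
  have hr : Submodule.span ℝ (Set.range fun e : S => id (e : X)) = L := by
    rw [hL]; simp
  let b : Module.Basis S ℝ L := (Module.Basis.span h.linearIndepOn).map (LinearEquiv.ofEq _ _ hr)
  have hb : ∀ e : S, ((b e : L) : X) = e := fun e => by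
    simp only [b, Module.Basis.map_apply, LinearEquiv.coe_ofEq_apply]
    exact congrArg Subtype.val (Module.Basis.span_apply h.linearIndepOn e)
  have hlat : ZLattice.comap ℝ Λ L.subtype = Submodule.span ℤ (Set.range b) := by
    refine le_antisymm (fun x hx => ?_) (Submodule.span_le.2 ?_)
    · have hxΛ : (x : X) ∈ Λ := hx
      have hx1 : (x : X) ∈ Submodule.span ℝ (S : Set X) := hL ▸ x.2
      choose k hk using fun e : S => h.integral e e.2 x hxΛ
      have hx2 : x = ∑ e : S, k e • b e := by
        ext
        rw [h.eq_sum_of_mem_span hx1, ← Finset.sum_coe_sort S]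
        simp only [AddSubmonoidClass.coe_finsetSum, Submodule.coe_smul_of_tower, hb, hk,
          Int.cast_smul_eq_zsmul]
      rw [hx2]
      exact Submodule.sum_mem _ fun e _ => Submodule.smul_mem _ _
        (Submodule.subset_span (Set.mem_range_self e))
    · rintro _ ⟨e, rfl⟩
      change ((b e : L) : X) ∈ Λ
      rw [hb]
      exact h.mem e e.2
  have hmem : ∀ t : S → ℝ, ∑ e, t e • (e : X) ∈ L := fun t =>
    Submodule.sum_mem _ fun e _ => Submodule.smul_mem _ _ (hb e ▸ (b e).2)
  refine ⟨hmem, ?_⟩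
  have hcov : ENNReal.ofReal (ZLattice.covolume (ZLattice.comap ℝ Λ L.subtype)) =
      volume (b.parallelepiped : Set L) := by
    rw [hlat, ZLattice.covolume_eq_measure_fundamentalDomain _ volume
      (ZSpan.isAddFundamentalDomain b volume),
      measureReal_congr (ZSpan.fundamentalDomain_ae_parallelepiped b volume),
      Module.Basis.coe_parallelepiped, measureReal_def, ENNReal.ofReal_toReal]
    rw [← Module.Basis.coe_parallelepiped]
    exact b.parallelepiped.isCompact.measure_lt_top.ne
  have hvol : (volume : Measure L) = volume (b.parallelepiped : Set L) • b.addHaar := by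
    rw [Module.Basis.addHaar_def]
    exact Measure.addHaarMeasure_unique volume b.parallelepiped
  have h0 : volume (b.parallelepiped : Set L) ≠ 0 :=
    (Measure.measure_pos_of_nonempty_interior _ b.parallelepiped.interior_nonempty).ne'
  rw [latticeMeasure, hcov]
  nth_rw 2 [hvol]
  rw [smul_smul, ENNReal.inv_mul_cancel h0 b.parallelepiped.isCompact.measure_lt_top.ne, one_smul,
    basis_addHaar_eq_map]
  congr 1
  funext t
  ext
  simp [hb]

theorem sum_mem_coneGen_iff (h : DualSystem Λ S c) (t : S → ℝ) :
    ∑ e, t e • (e : X) ∈ coneGen S ↔ ∀ e, 0 ≤ t e := by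
  classical
  let t' : X → ℝ := fun x => if hx : x ∈ S then t ⟨x, hx⟩ else 0
  have h1 : ∑ e, t e • (e : X) = ∑ e ∈ S, t' e • e := by
    rw [← Finset.sum_coe_sort S]
    exact Finset.sum_congr rfl fun e _ => by simp [t']
  rw [h1, h.mem_coneGen_iff]
  constructor
  · rintro ⟨h2, -⟩ e
    have := h2 e e.2
    rw [h.apply_sum t' e.2] at this
    simpa [t'] using this
  · intro h2
    refine ⟨fun e he => ?_, Finset.sum_congr rfl fun e he => by rw [h.apply_sum t' he]⟩
    rw [h.apply_sum t' he]
    simpa [t', he] using h2 ⟨e, he⟩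

theorem map_restrict_latticeMeasure (h : DualSystem Λ S c) :
    ((latticeMeasure Λ (vectorSpan ℝ (coneGen S))).restrict (inDirection (coneGen S))).map
      Subtype.val = coneMeasure halfLine S := by
  obtain ⟨hmem, hlat⟩ := h.latticeMeasure_eq_map _ (vectorSpan_coneGen S)
  have hm : Measurable fun t : S → ℝ => (⟨∑ e, t e • (e : X), hmem t⟩ : vectorSpan ℝ (coneGen S)) :=
    Measurable.subtype_mk (by fun_prop)
  have hpre : (fun t : S → ℝ => (⟨∑ e, t e • (e : X), hmem t⟩ : vectorSpan ℝ (coneGen S))) ⁻¹'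
      inDirection (coneGen S) = Set.univ.pi fun _ => Set.Ici 0 := by
    ext t
    simp only [inDirection, Set.mem_preimage, Set.mem_univ_pi, Set.mem_Ici]
    exact h.sum_mem_coneGen_iff t
  have hmeas : MeasurableSet (inDirection (coneGen S)) :=
    measurable_subtype_coe h.isSalient.isClosed.measurableSet
  -- The face corresponds to closed half lines and `halfLine` to open ones; they agree up to null
  -- sets.
  rw [hlat, Measure.restrict_map hm hmeas, Measure.map_map measurable_subtype_coe hm, hpre,
    volume_pi, Measure.restrict_pi_pi, coneMeasure, halfLine,
    Measure.restrict_congr_set Ioi_ae_eq_Ici]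
  rfl

theorem integral_inDirection (h : DualSystem Λ S c) (ψ : 𝓢(X, ℂ)) :
    ∫ x in inDirection (coneGen S), ψ (x : X)
      ∂(latticeMeasure Λ (vectorSpan ℝ (coneGen S))) = ∫ x, ψ x ∂coneMeasure halfLine S := by
  rw [← h.map_restrict_latticeMeasure, integral_map measurable_subtype_coe.aemeasurable
    ψ.continuous.aestronglyMeasurable]

theorem integrableOn_inDirection (h : DualSystem Λ S c) (ψ : 𝓢(X, ℂ)) :
    IntegrableOn (fun x : vectorSpan ℝ (coneGen S) => ψ (x : X)) (inDirection (coneGen S))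
      (latticeMeasure Λ (vectorSpan ℝ (coneGen S))) := by
  have h1 := integrable_coneMeasure_halfLine h.isSalient (fun e he => h.mem_coneGen he) ψ
  rw [← h.map_restrict_latticeMeasure, integrable_map_measure
    ψ.continuous.aestronglyMeasurable measurable_subtype_coe.aemeasurable] at h1
  exact h1

end DualSystem

/-! ### Riemann sums as integrals -/

theorem pi_smul_count {ι : Type*} [Fintype ι] (a : ℝ≥0) :
    (Measure.pi fun _ : ι => a • (Measure.count : Measure ℕ)) =
      (a ^ Fintype.card ι) • (Measure.count : Measure (ι → ℕ)) := by
  refine Measure.ext_of_singleton fun k => ?_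
  rw [Measure.pi_singleton]
  simp

theorem coneMeasure_sampling {N : ℕ} (hN : 0 < N) (A : Finset X) :
    coneMeasure (sampling N) A = (((N : ℝ≥0)⁻¹ ^ A.card) • (Measure.count : Measure (A → ℕ))).map
      fun k => (N : ℝ)⁻¹ • ∑ e : A, (k e : ℝ) • (e : X) := by
  have := sigmaFinite_sampling hN
  have h1 : (Measure.pi fun _ : A => sampling N) =
      (((N : ℝ≥0)⁻¹ ^ A.card) • (Measure.count : Measure (A → ℕ))).map
        fun k e => (k e : ℝ) / N := by
    have h2 := Measure.pi_map_pi (ι := A) (μ := fun _ => (N : ℝ≥0)⁻¹ • (Measure.count : Measure ℕ))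
      (f := fun _ (k : ℕ) => (k : ℝ) / N) (hμ := fun _ => sigmaFinite_sampling hN)
      fun _ => measurable_from_nat.aemeasurable
    rw [pi_smul_count, Fintype.card_coe] at h2
    exact h2.symm
  rw [coneMeasure, h1, Measure.map_map (by fun_prop) (measurable_of_countable _)]
  congr 1
  funext k
  simp only [Function.comp_apply, Finset.smul_sum, smul_smul]
  exact Finset.sum_congr rfl fun e _ => by rw [div_eq_inv_mul]

namespace DualSystem

variable {Λ : Submodule ℤ X} {E : Finset X} {c : X → X →L[ℝ] ℝ}

/-- The lattice points of a unimodular cone. -/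
def latticePoint (h : DualSystem Λ E c) (k : E → ℕ) : {γ : X // γ ∈ coneGen E ∧ γ ∈ Λ} :=
  ⟨∑ e : E, (k e : ℝ) • (e : X), (h.sum_mem_coneGen_iff _).2 fun _ => Nat.cast_nonneg _,
    Submodule.sum_mem _ fun e _ => by
      rw [Nat.cast_smul_eq_nsmul]
      exact Submodule.smul_of_tower_mem _ _ (h.mem e e.2)⟩

/-- The dual forms recover the coordinates. At a lattice point they are integers and on the cone
they are nonnegative, hence natural numbers. -/
theorem bijective_latticePoint (h : DualSystem Λ E c) : Function.Bijective h.latticePoint := by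
  classical
  have hval : ∀ (k : E → ℕ) (e : E), c e (h.latticePoint k : X) = k e := by
    intro k e
    simp only [latticePoint, map_sum, map_smul]
    rw [Finset.sum_eq_single_of_mem e (Finset.mem_univ e) fun f _ hfe => by
      rw [h.ne e e.2 f f.2 fun h' => hfe (Subtype.ext h'), smul_zero], h.self e e.2]
    simp
  constructor
  · intro k l hkl
    funext e
    have h1 := hval k e
    rw [hkl, hval l e] at h1
    exact_mod_cast h1.symm
  · rintro ⟨x, hx, hxΛ⟩
    obtain ⟨h1, h2⟩ := h.mem_coneGen_iff.1 hx
    have h3 : ∀ e : E, ∃ k : ℕ, c e x = k := fun e => by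
      obtain ⟨k, hk⟩ := h.integral e e.2 x hxΛ
      have h4 : 0 ≤ k := by
        have := h1 e e.2
        rw [hk] at this
        exact_mod_cast this
      obtain ⟨n, rfl⟩ := Int.eq_ofNat_of_zero_le h4
      exact ⟨n, by simpa using hk⟩
    choose k hk using h3
    refine ⟨k, Subtype.ext ?_⟩
    change ∑ e : E, (k e : ℝ) • (e : X) = x
    refine Eq.trans ?_ h2.symm
    rw [← Finset.sum_coe_sort E]
    exact Finset.sum_congr rfl fun e _ => by rw [hk]

theorem summable_and_riemannSum_eq (h : DualSystem Λ E c) (φ : 𝓢(X, ℂ)) {N : ℕ} (hN : 0 < N) :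
    (Summable fun γ : {γ : X // γ ∈ coneGen E ∧ γ ∈ Λ} => φ ((N : ℝ)⁻¹ • (γ : X))) ∧
      riemannSum Λ (coneGen E) φ N = ∫ x, φ x ∂coneMeasure (sampling N) E := by
  have := sigmaFinite_sampling hN
  obtain ⟨b, -, hb⟩ := exists_halfLineBound
  obtain ⟨p, B, hcb⟩ := exists_coneBound_coneMeasure h.isSalient b E fun e he => h.mem_coneGen he
  have hint : Integrable (fun x => φ x) (coneMeasure (sampling N) E) := by
    simpa using (hcb _ (hb N hN)).integrable_translate h.isSalient φ h.isSalient.zero_mem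
  have hm : Measurable fun k : E → ℕ => (N : ℝ)⁻¹ • ∑ e : E, (k e : ℝ) • (e : X) :=
    measurable_of_countable _
  let ε := Equiv.ofBijective _ h.bijective_latticePoint
  rw [coneMeasure_sampling hN, integrable_map_measure φ.continuous.aestronglyMeasurable
    hm.aemeasurable] at hint
  change Integrable _ ((((N : ℝ≥0)⁻¹ ^ E.card : ℝ≥0) : ENNReal) • Measure.count) at hint
  rw [integrable_smul_measure (ENNReal.coe_ne_zero.2 <|
    -- Removing the finite nonzero factor `N^{-|E|}` leaves counting measure, for which
    -- integrability is absolute summability.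
    pow_ne_zero _ (inv_ne_zero (Nat.cast_ne_zero.2 hN.ne'))) ENNReal.coe_ne_top] at hint
  have hs : Summable fun k : E → ℕ => φ ((N : ℝ)⁻¹ • (ε k : X)) :=
    summable_norm_iff.1 (integrable_count_iff.1 hint)
  refine ⟨(ε.summable_iff (f := fun γ : {γ : X // γ ∈ coneGen E ∧ γ ∈ Λ} =>
    φ ((N : ℝ)⁻¹ • (γ : X)))).1 hs, ?_⟩
  rw [coneMeasure_sampling hN, integral_map hm.aemeasurable φ.continuous.aestronglyMeasurable,
    integral_smul_nnreal_measure]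
  have hi := integral_countable hint
  simp only [Function.comp_apply] at hi
  rw [hi, riemannSum, h.sdim_coneGen,
    ← ε.tsum_eq]
  simp [measureReal_def, NNReal.smul_def, ε, latticePoint]

end DualSystem

end

section

variable {X : Type*} [NormedAddCommGroup X] [InnerProductSpace ℝ X] {Λ : Submodule ℤ X}

/-! ### Rational points -/

namespace IsRationalPoint

theorem of_mem {x : X} (h : x ∈ Λ) : IsRationalPoint Λ x :=
  ⟨1, one_ne_zero, by rwa [one_smul]⟩

theorem zero : IsRationalPoint Λ (0 : X) := of_mem Λ.zero_mem

theorem add {x y : X} (hx : IsRationalPoint Λ x) (hy : IsRationalPoint Λ y) :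
    IsRationalPoint Λ (x + y) := by
  obtain ⟨a, ha, hax⟩ := hx
  obtain ⟨b, hb, hby⟩ := hy
  refine ⟨a * b, mul_ne_zero ha hb, ?_⟩
  rw [smul_add, mul_smul a b y, mul_comm a b, mul_smul b a x]
  exact Λ.add_mem (Λ.smul_mem b hax) (Λ.smul_mem a hby)

theorem smul (q : ℚ) {x : X} (hx : IsRationalPoint Λ x) : IsRationalPoint Λ ((q : ℝ) • x) := by
  obtain ⟨a, ha, hax⟩ := hx
  refine ⟨a * q.den, mul_ne_zero ha (Int.natCast_ne_zero.2 q.den_nz), ?_⟩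
  have h1 : ((a * q.den : ℤ) • (q : ℝ) • x) = q.num • a • x := by
    simp only [← Int.cast_smul_eq_zsmul ℝ, smul_smul]
    congr 1
    push_cast
    have h2 : (q : ℝ) * q.den = q.num := by exact_mod_cast Rat.mul_den_eq_num q
    rw [mul_assoc, mul_comm (q.den : ℝ), h2, mul_comm]
  rw [h1]
  exact Λ.smul_mem _ hax

theorem sum {ι : Type*} (s : Finset ι) (f : ι → X) (h : ∀ i ∈ s, IsRationalPoint Λ (f i)) :
    IsRationalPoint Λ (∑ i ∈ s, f i) :=
  Finset.sum_induction f (IsRationalPoint Λ) (fun _ _ => add) zero h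

theorem sub {x y : X} (hx : IsRationalPoint Λ x) (hy : IsRationalPoint Λ y) :
    IsRationalPoint Λ (x - y) := by
  have h1 := hx.add (hy.smul (-1))
  rwa [Rat.cast_neg, Rat.cast_one, neg_one_smul, ← sub_eq_add_neg] at h1

end IsRationalPoint

/-- Gram–Schmidt carried out over `ℚ`: every quotient of inner products that occurs is rational
because the vectors involved remain rational points. Independence of `S` is not needed. -/
theorem IsRationalInner.exists_sub_orthogonal (hQ : IsRationalInner Λ) (S : Finset X)
    (hS : ∀ e ∈ S, IsRationalPoint Λ e) :
    ∀ x, IsRationalPoint Λ x →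
      ∃ q : X → ℚ, ∀ e ∈ S, inner ℝ e (x - ∑ v ∈ S, (q v : ℝ) • v) = 0 := by
  classical
  induction S using Finset.induction_on with
  | empty => exact fun x _ => ⟨0, by simp⟩
  | insert v S hv ih =>
    intro x hx
    have hS' : ∀ e ∈ S, IsRationalPoint Λ e := fun e he => hS e (Finset.mem_insert_of_mem he)
    have hrat : ∀ (q : X → ℚ) (y : X), IsRationalPoint Λ y →
        IsRationalPoint Λ (y - ∑ w ∈ S, (q w : ℝ) • w) := fun q y hy =>
      hy.sub (IsRationalPoint.sum _ _ fun w hw => (hS' w hw).smul _)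
    have hvr := hS v (Finset.mem_insert_self v S)
    obtain ⟨q, hq⟩ := ih hS' x hx
    obtain ⟨r, hr⟩ := ih hS' v hvr
    have hx'r := hrat q x hx
    have hv'r := hrat r v hvr
    set x' := x - ∑ w ∈ S, (q w : ℝ) • w
    set v' := v - ∑ w ∈ S, (r w : ℝ) • w with hv'
    obtain ⟨a, ha⟩ := hQ v' x' hv'r hx'r
    obtain ⟨b, hb⟩ := hQ v' v' hv'r hv'r
    have hnew : x - ∑ w ∈ insert v S, ((if w = v then a / b else q w - a / b * r w : ℚ) : ℝ) • w =
        x' - ((a / b : ℚ) : ℝ) • v' := by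
      rw [Finset.sum_insert hv, if_pos rfl]
      have h1 : ∑ w ∈ S, ((if w = v then a / b else q w - a / b * r w : ℚ) : ℝ) • w =
          ∑ w ∈ S, (q w : ℝ) • w - ((a / b : ℚ) : ℝ) • ∑ w ∈ S, (r w : ℝ) • w := by
        rw [Finset.smul_sum, ← Finset.sum_sub_distrib]
        refine Finset.sum_congr rfl fun w hw => ?_
        rw [if_neg (ne_of_mem_of_not_mem hw hv), smul_smul, ← sub_smul]
        push_cast
        rfl
      rw [h1, hv', smul_sub]
      simp only [x']
      abel
    have hS0 : ∀ e ∈ S, inner ℝ e (x' - ((a / b : ℚ) : ℝ) • v') = 0 := fun e he => by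
      rw [inner_sub_right, hq e he, inner_smul_right, hr e he, mul_zero, sub_zero]
    have hv0 : inner ℝ v' (x' - ((a / b : ℚ) : ℝ) • v') = 0 := by
      rw [inner_sub_right, inner_smul_right, ha, hb]
      -- If `b = 0`, then `v` already lies in the span of `S`, so `v' = 0` and `a = 0`; the
      -- convention `a / 0 = 0` gives a valid coefficient.
      rcases eq_or_ne b 0 with h0 | h0
      · have h2 : v' = 0 := by
          rw [← inner_self_eq_zero (𝕜 := ℝ), hb, h0, Rat.cast_zero]
        rw [h2, inner_zero_left] at ha
        rw [← ha, h0]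
        simp
      · have h0' : (b : ℝ) ≠ 0 := by exact_mod_cast h0
        push_cast
        field_simp
        ring
    refine ⟨fun w => if w = v then a / b else q w - a / b * r w, fun e he => ?_⟩
    rw [hnew]
    rcases Finset.mem_insert.1 he with rfl | he
    · have h1 : e = v' + ∑ w ∈ S, (r w : ℝ) • w := by rw [hv', sub_add_cancel]
      rw [h1, inner_add_left, hv0, sum_inner, zero_add]
      exact Finset.sum_eq_zero fun w hw => by rw [inner_smul_left, hS0 w hw, mul_zero]
    · exact hS0 e he

/-! ### Homogeneous rational operators -/

namespace IsRationalHomogeneousAlong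

variable {M : Submodule ℝ X} {k : ℕ} {D T : Op X}

theorem zero : IsRationalHomogeneousAlong Λ M k 0 := AddSubgroup.zero_mem _

theorem one : IsRationalHomogeneousAlong Λ M 0 1 :=
  AddSubgroup.subset_closure ⟨1, [], rfl, by simp, by simp⟩

theorem add (hD : IsRationalHomogeneousAlong Λ M k D) (hT : IsRationalHomogeneousAlong Λ M k T) :
    IsRationalHomogeneousAlong Λ M k (D + T) := AddSubgroup.add_mem _ hD hT

theorem sum {ι : Type*} (s : Finset ι) (f : ι → Op X)
    (h : ∀ i ∈ s, IsRationalHomogeneousAlong Λ M k (f i)) :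
    IsRationalHomogeneousAlong Λ M k (∑ i ∈ s, f i) := AddSubgroup.sum_mem _ h

theorem smul (q : ℚ) (hD : IsRationalHomogeneousAlong Λ M k D) :
    IsRationalHomogeneousAlong Λ M k ((q : ℝ) • D) := by
  refine AddSubgroup.closure_induction
    (p := fun D _ => IsRationalHomogeneousAlong Λ M k ((q : ℝ) • D)) ?_ ?_ ?_ ?_ hD
  · rintro _ ⟨r, w, hw, hwM, rfl⟩
    exact AddSubgroup.subset_closure ⟨q * r, w, hw, hwM, by rw [smul_smul, Rat.cast_mul]⟩
  · rw [smul_zero]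
    exact zero
  · intro D T _ _ hD hT
    rw [smul_add]
    exact hD.add hT
  · intro D _ hD
    rw [smul_neg]
    exact AddSubgroup.neg_mem _ hD

theorem mul_dirDeriv (hD : IsRationalHomogeneousAlong Λ M k D) {u : X} (hu : u ∈ M)
    (hr : IsRationalPoint Λ u) : IsRationalHomogeneousAlong Λ M (k + 1) (D * dirDeriv u) := by
  refine AddSubgroup.closure_induction
    (p := fun D _ => IsRationalHomogeneousAlong Λ M (k + 1) (D * dirDeriv u)) ?_ ?_ ?_ ?_ hD
  · rintro _ ⟨r, w, hw, hwM, rfl⟩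
    refine AddSubgroup.subset_closure ⟨r, w ++ [u], by simp [hw], fun x hx => ?_, by simp⟩
    rcases List.mem_append.1 hx with hx | hx
    · exact hwM x hx
    · rw [List.mem_singleton.1 hx]
      exact ⟨hu, hr⟩
  · rw [zero_mul]
    exact zero
  · intro D T _ _ hD hT
    rw [add_mul]
    exact hD.add hT
  · intro D _ hD
    rw [neg_mul]
    exact AddSubgroup.neg_mem _ hD

end IsRationalHomogeneousAlong

/-! ### The operators `𝒟_n` are homogeneous and rational -/

variable [FiniteDimensional ℝ X] {E : Finset X}

open Classical in
theorem IsRationalInner.exists_starProjection_eq (hQ : IsRationalInner Λ)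
    (hE : ∀ e ∈ E, IsRationalPoint Λ e) (I : Finset X) {x : X} (hx : IsRationalPoint Λ x) :
    ∃ q : X → ℚ, ∑ v ∈ E \ I, (q v : ℝ) • v = (spanCompl E I).starProjection x := by
  obtain ⟨q, hq⟩ := hQ.exists_sub_orthogonal (E \ I)
    (fun e he => hE e (Finset.mem_sdiff.1 he).1) x hx
  refine ⟨q, Eq.symm (Submodule.eq_starProjection_of_mem_orthogonal ?_ ?_)⟩
  · exact Submodule.sum_mem _ fun v hv => Submodule.smul_mem _ _ (Submodule.subset_span hv)
  · rw [spanCompl, Submodule.mem_orthogonal]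
    intro u hu
    induction hu using Submodule.span_induction with
    | mem u hu => exact hq u hu
    | zero => rw [inner_zero_left]
    | add u v _ _ hu hv => rw [inner_add_left, hu, hv, add_zero]
    | smul a u _ hu => rw [inner_smul_left, hu, mul_zero]

theorem IsRationalInner.isRationalPoint_perpPart (hQ : IsRationalInner Λ)
    (hE : ∀ e ∈ E, IsRationalPoint Λ e) (I : Finset X) {e : X} (he : e ∈ E) :
    IsRationalPoint Λ (perpPart E I e) := by
  classical
  obtain ⟨q, hq⟩ := hQ.exists_starProjection_eq hE I (hE e he)
  rw [perpPart, ← hq]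
  exact (hE e he).sub
    (IsRationalPoint.sum _ _ fun v hv => (hE v (Finset.mem_sdiff.1 hv).1).smul _)

open Classical in
theorem IsRationalInner.exists_projCoeff_eq (hQ : IsRationalInner Λ)
    (hE : ∀ e ∈ E, IsRationalPoint Λ e) (hli : LinearIndepOn ℝ id (E : Set X)) (I : Finset X)
    {e v : X} (he : e ∈ E) (hv : v ∈ E \ I) : ∃ q : ℚ, projCoeff E I e v = q := by
  obtain ⟨q, hq⟩ := hQ.exists_starProjection_eq hE I (hE e he)
  exact ⟨q v, projCoeff_unique hli (c := fun v => (q v : ℝ)) hq hv⟩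

-- Enlarging `I` shrinks the span of `E \ I`, so a vector orthogonal to it remains orthogonal to the
-- final face.
open Classical in
theorem perpPart_mem {I J : Finset X} (hIJ : I ⊆ J) {e : X} (he : e ∈ E) :
    perpPart E I e ∈ Submodule.span ℝ (E : Set X) ⊓
      (Submodule.span ℝ ((E \ J : Finset X) : Set X))ᗮ := by
  have h1 : spanCompl E I ≤ Submodule.span ℝ (E : Set X) :=
    Submodule.span_mono (Finset.coe_subset.2 Finset.sdiff_subset)
  have h2 : Submodule.span ℝ ((E \ J : Finset X) : Set X) ≤ spanCompl E I :=
    Submodule.span_mono (Finset.coe_subset.2 (Finset.sdiff_subset_sdiff le_rfl hIJ))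
  exact ⟨Submodule.sub_mem _ (Submodule.subset_span he)
    (h1 (Submodule.starProjection_apply_mem _ e)),
    Submodule.orthogonal_le h2 (Submodule.sub_starProjection_mem_orthogonal e)⟩

-- Of the steps in the list, `|J| - |I|` must enlarge `I` to reach `J`; all others differentiate.
-- Hence the order is `k` with `|I| + length = |J| + k`.
open Classical in
theorem IsRationalInner.isRationalHomogeneousAlong_ibpList (hQ : IsRationalInner Λ)
    (hE : ∀ e ∈ E, IsRationalPoint Λ e) (hli : LinearIndepOn ℝ id (E : Set X)) {J : Finset X}
    (hJ : J ⊆ E) (l : List X) (hl : ∀ e ∈ l, e ∈ E) :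
    ∀ (I : Finset X) (k : ℕ), I ⊆ J → I.card + l.length = J.card + k →
      IsRationalHomogeneousAlong Λ (Submodule.span ℝ (E : Set X) ⊓
        (Submodule.span ℝ ((E \ J : Finset X) : Set X))ᗮ) k (ibpList E l I J) := by
  induction l with
  | nil =>
    intro I k hIJ hk
    have h1 := Finset.card_le_card hIJ
    obtain rfl : k = 0 := by simp at hk; lia
    rw [ibpList]
    split_ifs
    · exact IsRationalHomogeneousAlong.one
    · exact IsRationalHomogeneousAlong.zero
  | cons e l ih =>
    have ih := ih fun f hf => hl f (List.mem_cons_of_mem e hf)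
    have he := hl e List.mem_cons_self
    intro I k hIJ hk
    rw [List.length_cons] at hk
    rw [ibpList]
    refine .add ?_ (.sum _ _ fun v hv => ?_)
    -- For `k = 0` no step can be spent on a derivative: the shortened list is too short to reach
    -- `J`, so this branch vanishes.
    · rcases k with _ | k
      · rw [ibpList_eq_zero_of_card_lt E l (by lia), zero_mul]
        exact .zero
      · exact (ih I k hIJ (by lia)).mul_dirDeriv (perpPart_mem hIJ he)
          (hQ.isRationalPoint_perpPart hE I he)
    · obtain ⟨hvJ, hvI⟩ := Finset.mem_sdiff.1 hv
      obtain ⟨q, hq⟩ := hQ.exists_projCoeff_eq hE hli I he (Finset.mem_sdiff.2 ⟨hJ hvJ, hvI⟩)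
      rw [hq]
      refine (ih (insert v I) k (Finset.insert_subset hvJ hIJ) ?_).smul q
      rw [Finset.card_insert_of_notMem hvI]
      lia

open Classical in
theorem IsRationalInner.isRationalHomogeneousAlong_indexOp (hQ : IsRationalInner Λ)
    (hE : ∀ e ∈ E, IsRationalPoint Λ e) (hli : LinearIndepOn ℝ id (E : Set X)) {J : Finset X}
    (hJ : J ⊆ E) {n : ℕ} (hn : J.card ≤ n) :
    IsRationalHomogeneousAlong Λ (Submodule.span ℝ (E : Set X) ⊓
      (Submodule.span ℝ ((E \ J : Finset X) : Set X))ᗮ) (n - J.card) (indexOp n E J) := by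
  have h1 : IsRationalHomogeneousAlong Λ (Submodule.span ℝ (E : Set X) ⊓
      (Submodule.span ℝ ((E \ J : Finset X) : Set X))ᗮ) (n - J.card)
      (∑ I ∈ J.powerset,
        ∑ ν ∈ (I.finsuppAntidiag n).filter (fun ν : X →₀ ℕ => ν.support = I),
          ((∏ e ∈ I, toddP (ν e) : ℚ) : ℝ) • ibpOp E I J (Finsupp.toMultiset ν - I.val)) := by
    refine .sum _ _ fun I hI => .sum _ _ fun ν hν => .smul _ ?_
    have hI := Finset.mem_powerset.1 hI
    have hcard := card_toMultiset_sub hν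
    refine hQ.isRationalHomogeneousAlong_ibpList hE hli hJ _ (fun e he => ?_) I _ hI ?_
    · have h2 := Multiset.mem_of_le (Multiset.sub_le_self _ _) (Multiset.mem_toList.1 he)
      rw [Finsupp.mem_toMultiset, (Finset.mem_filter.1 hν).2] at h2
      exact hJ (hI h2)
    · rw [Multiset.length_toList, hcard]
      lia
  have h2 := h1.smul ((-1) ^ (n - J.card))
  rwa [Rat.cast_pow, Rat.cast_neg, Rat.cast_one] at h2

theorem DualSystem.isRationalHomogeneousAlong_coneOp {c : X → X →L[ℝ] ℝ} (h : DualSystem Λ E c)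
    (hQ : IsRationalInner Λ) {n : ℕ} {F : Set X} (hF : F ∈ faces (coneGen E))
    (hn : sdim (coneGen E) ≤ sdim F + n) :
    IsRationalHomogeneousAlong Λ (vectorSpan ℝ (coneGen E) ⊓ (vectorSpan ℝ F)ᗮ)
      (sdim F + n - sdim (coneGen E)) (coneOp n E F) := by
  classical
  have hJ : faceIndex E F ⊆ E := Finset.filter_subset _ _
  have hF1 := h.eq_coneGen_of_mem_faces hF
  have h1 := h.sdim_face hJ
  have h2 : vectorSpan ℝ F = Submodule.span ℝ ((E \ faceIndex E F : Finset X) : Set X) := by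
    conv_lhs => rw [hF1]
    exact vectorSpan_coneGen _
  rw [← hF1] at h1
  rw [h.sdim_coneGen] at hn ⊢
  rw [coneOp_eq_indexOp, vectorSpan_coneGen, h2,
    show sdim F + n - E.card = n - (faceIndex E F).card by lia]
  exact hQ.isRationalHomogeneousAlong_indexOp (fun e he => .of_mem (h.mem e he)) h.linearIndepOn hJ
    (by lia)

end

section

variable {X : Type*} [NormedAddCommGroup X] [InnerProductSpace ℝ X] [FiniteDimensional ℝ X]
  [MeasurableSpace X] [BorelSpace X] {Λ : Submodule ℤ X} {E : Finset X} {c : X → X →L[ℝ] ℝ}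

/-! ### The asymptotic expansion -/

/-- Faces correspond bijectively to subsets `J` of `E`, with `J` recovered as the set of generators
off the face. The condition on dimensions becomes `|J| ≤ n`, matching the regrouped Euler–Maclaurin
coefficient at apex zero. -/
theorem DualSystem.expansionCoeff_eq (h : DualSystem Λ E c) (φ : 𝓢(X, ℂ)) (n : ℕ) :
    expansionCoeff Λ E φ n = emSum E n φ 0 := by
  classical
  have hset : {F : Set X | F ∈ faces (coneGen E) ∧ sdim (coneGen E) ≤ sdim F + n} =
      (fun J : Finset X => coneGen (E \ J)) ''
        (E.powerset.filter fun J => J.card ≤ n : Finset (Finset X)) := by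
    ext F
    simp only [Set.mem_ofPred_eq, Set.mem_image, Finset.mem_coe, Finset.mem_filter,
      Finset.mem_powerset]
    constructor
    · rintro ⟨hF, hn⟩
      have h1 : faceIndex E F ⊆ E := Finset.filter_subset _ _
      have h2 := h.sdim_face h1
      rw [← h.eq_coneGen_of_mem_faces hF] at h2
      rw [h.sdim_coneGen] at hn
      exact ⟨faceIndex E F, ⟨h1, by lia⟩, (h.eq_coneGen_of_mem_faces hF).symm⟩
    · rintro ⟨J, ⟨hJ, hn⟩, rfl⟩
      have h2 := h.sdim_face hJ
      rw [h.sdim_coneGen]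
      exact ⟨h.coneGen_mem_faces hJ, by lia⟩
  have hinj : Set.InjOn (fun J : Finset X => coneGen (E \ J))
      (E.powerset.filter fun J => J.card ≤ n : Finset (Finset X)) := by
    intro J hJ K hK hJK
    have hJ1 := Finset.mem_powerset.1 (Finset.mem_filter.1 hJ).1
    have hK1 := Finset.mem_powerset.1 (Finset.mem_filter.1 hK).1
    rw [← h.faceIndex_coneGen hJ1, ← h.faceIndex_coneGen hK1]
    exact congrArg (faceIndex E) hJK
  rw [expansionCoeff, hset, finsum_mem_image hinj, finsum_mem_coe_finset,
    emSum_eq_sum_indexOp h.isSalient (fun e he => h.mem_coneGen he)]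
  refine Finset.sum_congr rfl fun J hJ => ?_
  rw [coneOp_eq_indexOp, h.faceIndex_coneGen (Finset.mem_powerset.1 (Finset.mem_filter.1 hJ).1)]
  exact (h.mono Finset.sdiff_subset).integral_inDirection _

theorem DualSystem.isBigO_riemannSum (h : DualSystem Λ E c) (φ : 𝓢(X, ℂ)) {K : ℕ} (hK : 0 < K) :
    (fun N : ℕ => riemannSum Λ (coneGen E) φ N -
        ∑ n ∈ Finset.range K, ((N : ℂ) ^ n)⁻¹ * expansionCoeff Λ E φ n)
      =O[atTop] fun N : ℕ => ((N : ℝ) ^ K)⁻¹ := by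
  obtain ⟨D, -, hD⟩ := eulerMaclaurin_cone h.isSalient (fun e he => h.mem_coneGen he) φ K 0 hK
  refine IsBigO.of_bound (D * wt 0 (0 : X)) ?_
  filter_upwards [eventually_gt_atTop 0] with N hN
  have h1 := hD N hN 0 h.isSalient.zero_mem
  simp only [zero_add] at h1
  rw [(h.summable_and_riemannSum_eq φ hN).2, Real.norm_of_nonneg (by positivity)]
  simp only [h.expansionCoeff_eq, ← inv_pow]
  rw [← inv_pow] at h1
  linarith

/-- The case `K = 0` is deduced from `K = 1`: the cone estimate starts at `K = 1`, since for the
zero cone its induction begins with an exact leading term. -/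
theorem DualSystem.isBigO_riemannSum_zero (h : DualSystem Λ E c) (φ : 𝓢(X, ℂ)) :
    (fun N : ℕ => riemannSum Λ (coneGen E) φ N) =O[atTop] fun _ : ℕ => (1 : ℝ) := by
  have h1 := h.isBigO_riemannSum φ one_pos
  simp only [Finset.sum_range_one, pow_zero, inv_one, one_mul, pow_one] at h1
  have h2 : (fun N : ℕ => (N : ℝ)⁻¹) =O[atTop] fun _ : ℕ => (1 : ℝ) :=
    (tendsto_inv_atTop_nhds_zero_nat (𝕜 := ℝ)).isBigO_one ℝ
  have h3 := (h1.trans h2).add (isBigO_const_const (expansionCoeff Λ E φ 0) one_ne_zero atTop)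
  simpa using h3

theorem DualSystem.integrableOn_coneOp (h : DualSystem Λ E c) (φ : 𝓢(X, ℂ)) (n : ℕ) {F : Set X}
    (hF : F ∈ faces (coneGen E)) :
    IntegrableOn (fun x : vectorSpan ℝ F => coneOp n E F φ (x : X)) (inDirection F)
      (latticeMeasure Λ (vectorSpan ℝ F)) := by
  classical
  have h1 : ∀ ψ : 𝓢(X, ℂ), IntegrableOn (fun x : vectorSpan ℝ F => ψ (x : X)) (inDirection F)
      (latticeMeasure Λ (vectorSpan ℝ F)) := by
    rw [h.eq_coneGen_of_mem_faces hF]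
    exact (h.mono Finset.sdiff_subset).integrableOn_inDirection
  exact h1 _

end

end ConeEM

end

/-! ### The main theorem. -/

theorem mainTheorem3 {X : Type*} [NormedAddCommGroup X] [InnerProductSpace ℝ X]
    [FiniteDimensional ℝ X] [MeasurableSpace X] [BorelSpace X]
    (Λ : Submodule ℤ X) [DiscreteTopology Λ] [IsZLattice ℝ Λ]
    (hQ : ConeEM.IsRationalInner Λ)
    (C : Set X) (E : Finset X) (hE : ConeEM.IsPartOfIntegralBasis Λ E)
    (hC : C = ConeEM.coneGen E) :
    (ConeEM.faces C).Finite ∧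
    (∀ (n : ℕ), ∀ F ∈ ConeEM.faces C, ConeEM.sdim C ≤ ConeEM.sdim F + n →
      ConeEM.IsRationalHomogeneousAlong Λ (vectorSpan ℝ C ⊓ (vectorSpan ℝ F)ᗮ)
        (ConeEM.sdim F + n - ConeEM.sdim C) (ConeEM.coneOp n E F)) ∧
    ∀ φ : 𝓢(X, ℂ),
      (∀ N : ℕ, 0 < N →
        Summable fun γ : {γ : X // γ ∈ C ∧ γ ∈ Λ} => φ ((N : ℝ)⁻¹ • (γ : X))) ∧
      (∀ (n : ℕ), ∀ F ∈ ConeEM.faces C, ConeEM.sdim C ≤ ConeEM.sdim F + n →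
        IntegrableOn (fun x : vectorSpan ℝ F => ConeEM.coneOp n E F φ (x : X))
          (ConeEM.inDirection F) (ConeEM.latticeMeasure Λ (vectorSpan ℝ F))) ∧
      ∀ K : ℕ,
        (fun N : ℕ => ConeEM.riemannSum Λ C φ N -
            ∑ n ∈ Finset.range K, ((N : ℂ) ^ n)⁻¹ * ConeEM.expansionCoeff Λ E φ n)
          =O[atTop] fun N : ℕ => ((N : ℝ) ^ K)⁻¹ := by
  subst hC
  obtain ⟨c, h⟩ := ConeEM.exists_dualSystem Λ hE
  refine ⟨h.finite_faces, fun n F hF hn => h.isRationalHomogeneousAlong_coneOp hQ hF hn,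
    fun φ => ⟨fun N hN => (h.summable_and_riemannSum_eq φ hN).1,
      fun n F hF _ => h.integrableOn_coneOp φ n hF, fun K => ?_⟩⟩
  rcases K.eq_zero_or_pos with rfl | hK
  · simpa using h.isBigO_riemannSum_zero φ
  · exact h.isBigO_riemannSum φ hK
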